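/- Let $\mathbb K$ be a field, let $q\in\mathbb K$ be nonzero and not a root of unity, and let $\rho\in\mathbb K$ be nonzero. Write $[X,Y]=XY-YX$, $[X,Y]_q=qXY-q^{-1}YX$, and $\mathbb Z_+=\{0,1,2,\dots\}$. Let $\mathcal A_q$ be the associative unital $\mathbb K$-algebra with generators $\mathcal W_{-k},\mathcal W_{k+1},\mathcal G_{k+1},\tilde{\mathcal G}_{k+1}$ ($k\in\mathbb Z_+$) and the following relations. Put $U=\frac{qu^2+q^{-1}u^{-2}}{q+q^{-1}}$, $V=\frac{qv^2+q^{-1}v^{-2}}{q+q^{-1}}$ and $$\mathcal W_+(u)=\sum_{k\ge0}\mathcal W_{-k}U^{-k-1},\quad \mathcal W_-(u)=\sum_{k\ge0}\mathcal W_{k+1}U^{-k-1},\quad \mathcal G_+(u)=\sum_{k\ge0}\mathcal G_{k+1}U^{-k-1},\quad \mathcal G_-(u)=\sum_{k\ge0}\tilde{\mathcal G}_{k+1}U^{-k-1},$$ and likewise with $v,V$. The defining relations are the following identities of formal series in $U^{-1},V^{-1}$ (for both choices of sign, and for $\epsilon=\pm$): $$[\mathcal W_\pm(u),\mathcal W_\pm(v)]=0,\qquad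 [\mathcal W_+(u),\mathcal W_-(v)]+[\mathcal W_-(u),\mathcal W_+(v)]=0,$$ $$(U-V)[\mathcal W_\pm(u),\mathcal W_\mp(v)]=\tfrac{q-q^{-1}}{\rho(q+q^{-1})}\big(\mathcal G_\pm(u)\mathcal G_\mp(v)-\mathcal G_\pm(v)\mathcal G_\mp(u)\big)+\tfrac1{q+q^{-1}}\big(\mathcal G_\pm(u)-\mathcal G_\mp(u)+\mathcal G_\mp(v)-\mathcal G_\pm(v)\big),$$ $$\mathcal W_\pm(u)\mathcal W_\pm(v)-\mathcal W_\mp(u)\mathcal W_\mp(v)+\tfrac1{\rho(q^2-q^{-2})}[\mathcal G_\pm(u),\mathcal G_\mp(v)]+\tfrac{1-UV}{U-V}\big(\mathcal W_\pm(u)\mathcal W_\mp(v)-\mathcal W_\pm(v)\mathcal W_\mp(u)\big)=0,$$ $$U[\mathcal G_\mp(v),\mathcal W_\pm(u)]_q-V[\mathcal G_\mp(u),\mathcal W_\pm(v)]_q-(q-q^{-1})\big(\mathcal W_\mp(u)\mathcal G_\mp(v)-\mathcal W_\mp(v)\mathcal G_\mp(u)\big)+\rho\big(U\mathcal W_\pm(u)-V\mathcal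 W_\pm(v)-\mathcal W_\mp(u)+\mathcal W_\mp(v)\big)=0,$$ $$U[\mathcal W_\mp(u),\mathcal G_\mp(v)]_q-V[\mathcal W_\mp(v),\mathcal G_\mp(u)]_q-(q-q^{-1})\big(\mathcal W_\pm(u)\mathcal G_\mp(v)-\mathcal W_\pm(v)\mathcal G_\mp(u)\big)+\rho\big(U\mathcal W_\mp(u)-V\mathcal W_\mp(v)-\mathcal W_\pm(u)+\mathcal W_\pm(v)\big)=0,$$ $$[\mathcal G_\epsilon(u),\mathcal W_\pm(v)]+[\mathcal W_\pm(u),\mathcal G_\epsilon(v)]=0,\qquad [\mathcal G_\pm(u),\mathcal G_\pm(v)]=0,\qquad [\mathcal G_+(u),\mathcal G_-(v)]+[\mathcal G_-(u),\mathcal G_+(v)]=0.$$ Let $$\begin{aligned}\Delta(u)={}&-(q-q^{-1})(q^2+q^{-2})\big(\mathcal W_+(u)\mathcal W_+(uq)+\mathcal W_-(u)\mathcal W_-(uq)\big)-\tfrac{q-q^{-1}}{\rho}\big(\mathcal G_+(u)\mathcal G_-(uq)+\mathcal G_-(u)\mathcal G_+(uq)\big)\\&+(q-q^{-1})(u^2q^2+u^{-2}q^{-2})\big(\mathcal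 W_+(u)\mathcal W_-(uq)+\mathcal W_-(u)\mathcal W_+(uq)\big)-\mathcal G_+(u)-\mathcal G_+(uq)-\mathcal G_-(u)-\mathcal G_-(uq),\end{aligned}$$ expanded about $u=\infty$, that is, as a formal Laurent series in $u^{-1}$ with coefficients in $\mathcal A_q$. For $k\in\mathbb Z_+$ put $[\frac k2]=\frac k2$, $\bar k=1$ if $k$ is even and $[\frac k2]=\frac{k-1}2$, $\bar k=0$ if $k$ is odd. For $i,j,m\in\mathbb Z_+$ put $$\begin{aligned}\mathbb G_{i+1}&=\mathcal G_{i+1}+\tilde{\mathcal G}_{i+1},\qquad \mathbb W_{ij}=(q-q^{-1})(\mathcal W_{-i}\mathcal W_{j+1}+\mathcal W_{i+1}\mathcal W_{-j}),\\ \mathbb F_{ij}&=(q-q^{-1})\Big((q^2+q^{-2})(\mathcal W_{-i}\mathcal W_{-j}+\mathcal W_{i+1}\mathcal W_{j+1})+\tfrac1\rho(\mathcal G_{j+1}\tilde{\mathcal G}_{i+1}+\tilde{\mathcal G}_{j+1}\mathcal G_{i+1})\Big),\end{aligned}$$ $$w_m^i=(-1)^m\tfrac{(m+i)!}{m!\,i!}(q+q^{-1})^{i+1}q^{-i-2m-1},\qquad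 w_{-1}^i=0,\qquad c_{k+1}=-\frac{(q+q^{-1})^{k+1}(q^{k+1}+q^{-k-1})}{q^{2k+2}}$$ (with $\frac{(m+i)!}{m!\,i!}$ read as an integer mapped into $\mathbb K$). Then $c_{k+1}\neq0$ for all $k\in\mathbb Z_+$; let $$\begin{aligned}e_{ij}^{(k)}&=-c_{k+1}^{-1}\sum_{m=0}^{[\frac k2]-\frac{i+j+\bar k}2}w^i_{[\frac k2]-\frac{i+j+\bar k}2-m}\,w_m^j\,q^{-2j-4m-2},\\ f_{ij}^{(k)}&=c_{k+1}^{-1}\sum_{m=0}^{[\frac k2]-\frac{i+j+\bar k-1}2}w^i_{[\frac k2]-\frac{i+j+\bar k-1}2-m}\,(w_m^j+w_{m-1}^j)\,q^{-2j-4m},\\ d_l^{(k)}&=-c_{k+1}^{-1}\,w_{[\frac k2]-l}^{2l+1-\bar k}\,(1+q^{-2k-2}),\end{aligned}$$ for those indices that occur in $$\Delta_{k+1}=\mathbb G_{k+1}+\sum_{l=0}^{[\frac k2]-1}d_l^{(k)}\mathbb G_{2(l+1)-\bar k}+\sum_{l=0}^{[\frac k2]}\ \sum_{i+j=2l+1-\bar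 k}f_{ij}^{(k)}\mathbb W_{ij}+\sum_{l=0}^{[\frac k2]-\bar k}\ \sum_{i+j=2l+\bar k}e_{ij}^{(k)}\mathbb F_{ij}$$ (inner sums over $i,j\in\mathbb Z_+$; a sum with upper limit $-1$ is empty). Then, about $u=\infty$, $$\Delta(u)=\sum_{k=0}^\infty u^{-2k-2}\,c_{k+1}\,\Delta_{k+1},$$ and every $\Delta_{k+1}$ is central in $\mathcal A_q$: $[\Delta_{k+1},\mathcal X]=0$ for all $k\in\mathbb Z_+$ and all $\mathcal X\in\mathcal A_q$. -/

import Mathlib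

noncomputable section

namespace QOnsager

/-- The two signs `±` labelling the currents. -/
inductive Sgn
  | plus
  | minus

/-- The opposite sign `∓`. -/
def Sgn.opp : Sgn → Sgn
  | .plus => .minus
  | .minus => .plus

/-- The generator symbols, for `k : ℕ`:
`W plus k` is `𝒲_{-k}`, `W minus k` is `𝒲_{k+1}`,
`G plus k` is `𝒢_{k+1}`, `G minus k` is `𝒢̃_{k+1}`. -/
inductive Gen
  | W (e : Sgn) (k : ℕ)
  | G (e : Sgn) (k : ℕ)

/-- The `q`-commutator `[X, Y]_q = q X Y - q⁻¹ Y X`. -/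
def qComm {K R : Type*} [Field K] [Ring R] [Algebra K R] (q : K) (X Y : R) : R :=
  q • (X * Y) - q⁻¹ • (Y * X)

/-! ### Formal series in two commuting indeterminates `U⁻¹`, `V⁻¹`

The inner Laurent variable is `U⁻¹`, the outer one is `V⁻¹`; both commute with the coefficients. -/

/-- Formal Laurent series in `V⁻¹` whose coefficients are formal Laurent series in `U⁻¹`. -/
abbrev BiSeries (A : Type*) [Ring A] := LaurentSeries (LaurentSeries A)

section BiSeries

variable {A : Type*} [Ring A]

/-- The indeterminate `U`. -/
def serU : BiSeries A := HahnSeries.C (HahnSeries.single (-1) 1)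

/-- The indeterminate `V`. -/
def serV : BiSeries A := HahnSeries.single (-1) 1

/-- The current `∑_{k ≥ 0} a_k U^{-k-1}`. -/
def atU (a : ℕ → A) : BiSeries A :=
  HahnSeries.C (HahnSeries.single 1 1 * HahnSeries.ofPowerSeries ℤ A (PowerSeries.mk a))

/-- The current `∑_{k ≥ 0} a_k V^{-k-1}`. -/
def atV (a : ℕ → A) : BiSeries A :=
  HahnSeries.single 1 1 *
    HahnSeries.ofPowerSeries ℤ (LaurentSeries A) (PowerSeries.mk fun k => HahnSeries.C (a k))

/-- The coefficient of `U^{-m} V^{-n}`. -/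
def biCoeff (f : BiSeries A) (m n : ℤ) : A := (HahnSeries.coeff f n).coeff m

end BiSeries

/-! ### The algebra `𝒜_q` -/

section Algebra

variable {K : Type*} [Field K]

/-- `W_±(u)` in the free algebra. -/
def Wu (K : Type*) [Field K] (e : Sgn) : BiSeries (FreeAlgebra K Gen) :=
  atU fun k => FreeAlgebra.ι K (Gen.W e k)

/-- `W_±(v)` in the free algebra. -/
def Wv (K : Type*) [Field K] (e : Sgn) : BiSeries (FreeAlgebra K Gen) :=
  atV fun k => FreeAlgebra.ι K (Gen.W e k)

/-- `G_±(u)` in the free algebra. -/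
def Gu (K : Type*) [Field K] (e : Sgn) : BiSeries (FreeAlgebra K Gen) :=
  atU fun k => FreeAlgebra.ι K (Gen.G e k)

/-- `G_±(v)` in the free algebra. -/
def Gv (K : Type*) [Field K] (e : Sgn) : BiSeries (FreeAlgebra K Gen) :=
  atV fun k => FreeAlgebra.ι K (Gen.G e k)

/-- The defining relations of `𝒜_q`, as equations `lhs = rhs` between formal series in
`U⁻¹`, `V⁻¹` (with upper signs for `e = plus`, lower signs for `e = minus`).
The relation `ww_gg` is the one that carries the fraction `(1 - U V) / (U - V)`; it is multiplied
by `U - V`, which is not a zero divisor. -/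
inductive SeriesRel (q ρ : K) :
    BiSeries (FreeAlgebra K Gen) → BiSeries (FreeAlgebra K Gen) → Prop
  | w_comm (e : Sgn) : SeriesRel q ρ ⁅Wu K e, Wv K e⁆ 0
  | w_cross : SeriesRel q ρ
      (⁅Wu K .plus, Wv K .minus⁆ + ⁅Wu K .minus, Wv K .plus⁆) 0
  | w_w (e : Sgn) : SeriesRel q ρ
      ((serU - serV) * ⁅Wu K e, Wv K e.opp⁆)
      (((q - q⁻¹) / (ρ * (q + q⁻¹))) • (Gu K e * Gv K e.opp - Gv K e * Gu K e.opp)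
        + (1 / (q + q⁻¹)) • (Gu K e - Gu K e.opp + Gv K e.opp - Gv K e))
  | ww_gg (e : Sgn) : SeriesRel q ρ
      ((serU - serV) *
          (Wu K e * Wv K e - Wu K e.opp * Wv K e.opp
            + (1 / (ρ * (q ^ 2 - q⁻¹ ^ 2))) • ⁅Gu K e, Gv K e.opp⁆)
        + (1 - serU * serV) * (Wu K e * Wv K e.opp - Wv K e * Wu K e.opp)) 0
  | g_w (e : Sgn) : SeriesRel q ρ
      (serU * qComm q (Gv K e.opp) (Wu K e) - serV * qComm q (Gu K e.opp) (Wv K e)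
        - (q - q⁻¹) • (Wu K e.opp * Gv K e.opp - Wv K e.opp * Gu K e.opp)
        + ρ • (serU * Wu K e - serV * Wv K e - Wu K e.opp + Wv K e.opp)) 0
  | w_g (e : Sgn) : SeriesRel q ρ
      (serU * qComm q (Wu K e.opp) (Gv K e.opp) - serV * qComm q (Wv K e.opp) (Gu K e.opp)
        - (q - q⁻¹) • (Wu K e * Gv K e.opp - Wv K e * Gu K e.opp)
        + ρ • (serU * Wu K e.opp - serV * Wv K e.opp - Wu K e + Wv K e)) 0
  | g_w_comm (d e : Sgn) : SeriesRel q ρ (⁅Gu K d, Wv K e⁆ + ⁅Wu K e, Gv K d⁆) 0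
  | g_comm (e : Sgn) : SeriesRel q ρ ⁅Gu K e, Gv K e⁆ 0
  | g_cross : SeriesRel q ρ
      (⁅Gu K .plus, Gv K .minus⁆ + ⁅Gu K .minus, Gv K .plus⁆) 0

/-- The relations between elements of the free algebra: equality of all coefficients. -/
def Rel (q ρ : K) (a b : FreeAlgebra K Gen) : Prop :=
  ∃ (f g : BiSeries (FreeAlgebra K Gen)) (m n : ℤ),
    SeriesRel q ρ f g ∧ a = biCoeff f m n ∧ b = biCoeff g m n

/-- The algebra `𝒜_q` (with parameter `ρ`), by generators and relations. -/
abbrev Aq (q ρ : K) := RingQuot (Rel q ρ)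

/-- `Wgen q ρ plus k = 𝒲_{-k}` and `Wgen q ρ minus k = 𝒲_{k+1}` in `𝒜_q`. -/
def Wgen (q ρ : K) (e : Sgn) (k : ℕ) : Aq q ρ :=
  RingQuot.mkAlgHom K (Rel q ρ) (FreeAlgebra.ι K (Gen.W e k))

/-- `Ggen q ρ plus k = 𝒢_{k+1}` and `Ggen q ρ minus k = 𝒢̃_{k+1}` in `𝒜_q`. -/
def Ggen (q ρ : K) (e : Sgn) (k : ℕ) : Aq q ρ :=
  RingQuot.mkAlgHom K (Rel q ρ) (FreeAlgebra.ι K (Gen.G e k))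

end Algebra

/-! ### Expansions about `u = ∞`

Here the Laurent variable is `u⁻¹`, so `HahnSeries.single n a` stands for `a u^{-n}`. -/

section Expansion

variable {K : Type*} [Field K]

/-- `U(tu) = (q t² u² + q⁻¹ t⁻² u⁻²) / (q + q⁻¹)`, an element of the field `K((u⁻¹))`. -/
def Uexp (q t : K) : LaurentSeries K :=
  HahnSeries.single (-2) (q * t ^ 2 / (q + q⁻¹))
    + HahnSeries.single 2 (q⁻¹ * t⁻¹ ^ 2 / (q + q⁻¹))

/-- `U(tu)^{-k-1}` in the field `K((u⁻¹))`. -/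
def Upow (q t : K) (k : ℕ) : LaurentSeries K := ((Uexp q t)⁻¹) ^ (k + 1)

/-- The current `∑_{k ≥ 0} a_k U(tu)^{-k-1}`, expanded about `u = ∞`. As `U(tu)^{-k-1}` is
divisible by `u^{-2k-2}`, only the `k < n` contribute to the coefficient of `u^{-n}`
(see `Upow_coeff_eq_zero`). -/
def expCurrent {A : Type*} [Ring A] [Algebra K A] (q t : K) (a : ℕ → A) : LaurentSeries A :=
  HahnSeries.ofPowerSeries ℤ A
    (PowerSeries.mk fun n => ∑ k ∈ Finset.range n, (Upow q t k).coeff (n : ℤ) • a k)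

theorem Uexp_order {q t : K} (hq : q ≠ 0) (hq2 : q + q⁻¹ ≠ 0) (ht : t ≠ 0) :
    Uexp q t ≠ 0 ∧ (Uexp q t).order = -2 := by
  have hc : q * t ^ 2 / (q + q⁻¹) ≠ 0 := div_ne_zero (mul_ne_zero hq (pow_ne_zero _ ht)) hq2
  have h2 : (Uexp q t).coeff (-2) ≠ 0 := by
    simpa [Uexp, HahnSeries.coeff_single] using hc
  have h0 : Uexp q t ≠ 0 := by
    intro h
    simp [h] at h2
  refine ⟨h0, le_antisymm (HahnSeries.order_le_of_coeff_ne_zero h2) ?_⟩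
  by_contra hlt
  push Not at hlt
  refine HahnSeries.coeff_order_eq_zero.not.mpr h0 ?_
  have h3 : (Uexp q t).order ≠ -2 := by omega
  have h4 : (Uexp q t).order ≠ 2 := by omega
  simp only [Uexp] at h3 h4 ⊢
  rw [HahnSeries.coeff_add, HahnSeries.coeff_single_of_ne h3, HahnSeries.coeff_single_of_ne h4,
    add_zero]

theorem Upow_coeff_eq_zero {q t : K} (hq : q ≠ 0) (hq2 : q + q⁻¹ ≠ 0) (ht : t ≠ 0)
    (k : ℕ) (n : ℤ) (hn : n < 2 * k + 2) : (Upow q t k).coeff n = 0 := by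
  obtain ⟨h0, ho⟩ := Uexp_order hq hq2 ht
  apply HahnSeries.coeff_eq_zero_of_lt_order
  have hi : ((Uexp q t)⁻¹).order = 2 := by
    have h := HahnSeries.order_mul h0 (inv_ne_zero h0)
    rw [mul_inv_cancel₀ h0, HahnSeries.order_one, ho] at h
    omega
  rw [Upow, HahnSeries.order_pow, hi]
  simp only [nsmul_eq_mul]
  push_cast
  linarith

/-- `W_±(tu)` in `𝒜_q`, expanded about `u = ∞`. -/
def Wexp (q ρ t : K) (e : Sgn) : LaurentSeries (Aq q ρ) := expCurrent q t (Wgen q ρ e)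

/-- `G_±(tu)` in `𝒜_q`, expanded about `u = ∞`. -/
def Gexp (q ρ t : K) (e : Sgn) : LaurentSeries (Aq q ρ) := expCurrent q t (Ggen q ρ e)

/-- The expansion about `u = ∞` of
`Δ(u) = -(q - q⁻¹)(q² + q⁻²)(W₊(u)W₊(uq) + W₋(u)W₋(uq))`
`- (q - q⁻¹)/ρ (G₊(u)G₋(uq) + G₋(u)G₊(uq))`
`+ (q - q⁻¹)(u²q² + u⁻²q⁻²)(W₊(u)W₋(uq) + W₋(u)W₊(uq))`
`- G₊(u) - G₊(uq) - G₋(u) - G₋(uq)`. -/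
def DeltaSeries (q ρ : K) : LaurentSeries (Aq q ρ) :=
  -(((q - q⁻¹) * (q ^ 2 + q⁻¹ ^ 2)) •
      (Wexp q ρ 1 .plus * Wexp q ρ q .plus + Wexp q ρ 1 .minus * Wexp q ρ q .minus))
    - ((q - q⁻¹) / ρ) •
      (Gexp q ρ 1 .plus * Gexp q ρ q .minus + Gexp q ρ 1 .minus * Gexp q ρ q .plus)
    + (q - q⁻¹) •
      ((HahnSeries.single (-2) (algebraMap K (Aq q ρ) (q ^ 2))
          + HahnSeries.single 2 (algebraMap K (Aq q ρ) (q⁻¹ ^ 2))) *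
        (Wexp q ρ 1 .plus * Wexp q ρ q .minus + Wexp q ρ 1 .minus * Wexp q ρ q .plus))
    - Gexp q ρ 1 .plus - Gexp q ρ q .plus - Gexp q ρ 1 .minus - Gexp q ρ q .minus

end Expansion

/-! ### The explicit formula -/

section Formula

variable {K : Type*} [Field K]

/-- `k̄ = 1` for `k` even and `0` for `k` odd. -/
def bar (k : ℕ) : ℕ := if Even k then 1 else 0

/-- `w_m^i = (-1)^m (m+i)!/(m! i!) (q + q⁻¹)^{i+1} q^{-i-2m-1}`. -/
def w (q : K) (m i : ℕ) : K :=
  (-1) ^ m * ((m + i).choose i : K) * (q + q⁻¹) ^ (i + 1) * q ^ (-(i : ℤ) - 2 * m - 1)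

/-- `w_{m-1}^i`, with the convention `w_{-1}^i = 0`. -/
def wPred (q : K) (m i : ℕ) : K := if m = 0 then 0 else w q (m - 1) i

/-- `cc q k = c_{k+1} = -(q + q⁻¹)^{k+1} (q^{k+1} + q^{-k-1}) / q^{2k+2}`. -/
def cc (q : K) (k : ℕ) : K :=
  -((q + q⁻¹) ^ (k + 1) * (q ^ (k + 1) + q⁻¹ ^ (k + 1)) / q ^ (2 * k + 2))

/-- `e_{ij}^{(k)}`. -/
def eCoef (q : K) (k i j : ℕ) : K :=
  -(cc q k)⁻¹ * ∑ m ∈ Finset.range (k / 2 - (i + j + bar k) / 2 + 1),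
    w q (k / 2 - (i + j + bar k) / 2 - m) i * w q m j * q ^ (-2 * (j : ℤ) - 4 * m - 2)

/-- `f_{ij}^{(k)}`. -/
def fCoef (q : K) (k i j : ℕ) : K :=
  (cc q k)⁻¹ * ∑ m ∈ Finset.range (k / 2 - (i + j + bar k - 1) / 2 + 1),
    w q (k / 2 - (i + j + bar k - 1) / 2 - m) i * (w q m j + wPred q m j) *
      q ^ (-2 * (j : ℤ) - 4 * m)

/-- `d_l^{(k)}`. -/
def dCoef (q : K) (k l : ℕ) : K :=
  -(cc q k)⁻¹ * w q (k / 2 - l) (2 * l + 1 - bar k) * (1 + q ^ (-2 * (k : ℤ) - 2))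

/-- `bbG q ρ i = 𝔾_{i+1} = 𝒢_{i+1} + 𝒢̃_{i+1}`. -/
def bbG (q ρ : K) (i : ℕ) : Aq q ρ := Ggen q ρ .plus i + Ggen q ρ .minus i

/-- `𝕎_{ij} = (q - q⁻¹)(𝒲_{-i} 𝒲_{j+1} + 𝒲_{i+1} 𝒲_{-j})`. -/
def bbW (q ρ : K) (i j : ℕ) : Aq q ρ :=
  (q - q⁻¹) • (Wgen q ρ .plus i * Wgen q ρ .minus j + Wgen q ρ .minus i * Wgen q ρ .plus j)

/-- `𝔽_{ij} = (q - q⁻¹)((q² + q⁻²)(𝒲_{-i} 𝒲_{-j} + 𝒲_{i+1} 𝒲_{j+1})`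
`+ ρ⁻¹ (𝒢_{j+1} 𝒢̃_{i+1} + 𝒢̃_{j+1} 𝒢_{i+1}))`. -/
def bbF (q ρ : K) (i j : ℕ) : Aq q ρ :=
  (q - q⁻¹) •
    ((q ^ 2 + q⁻¹ ^ 2) •
        (Wgen q ρ .plus i * Wgen q ρ .plus j + Wgen q ρ .minus i * Wgen q ρ .minus j)
      + (1 / ρ) •
        (Ggen q ρ .plus j * Ggen q ρ .minus i + Ggen q ρ .minus j * Ggen q ρ .plus i))

/-- `DeltaCoef q ρ k = Δ_{k+1}`, by the explicit formula
`Δ_{k+1} = 𝔾_{k+1} + ∑_{l=0}^{[k/2]-1} d_l^{(k)} 𝔾_{2(l+1)-k̄}`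
`+ ∑_{l=0}^{[k/2]} ∑_{i+j=2l+1-k̄} f_{ij}^{(k)} 𝕎_{ij}`
`+ ∑_{l=0}^{[k/2]-k̄} ∑_{i+j=2l+k̄} e_{ij}^{(k)} 𝔽_{ij}`.
Since `bbG` is shifted by one, `𝔾_{2(l+1)-k̄}` is `bbG q ρ (2l+1-k̄)`; the last outer sum is empty
for `k = 0`. -/
def DeltaCoef (q ρ : K) (k : ℕ) : Aq q ρ :=
  bbG q ρ k
    + ∑ l ∈ Finset.range (k / 2), dCoef q k l • bbG q ρ (2 * l + 1 - bar k)
    + ∑ l ∈ Finset.range (k / 2 + 1),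
        ∑ p ∈ Finset.HasAntidiagonal.antidiagonal (2 * l + 1 - bar k),
        fCoef q k p.1 p.2 • bbW q ρ p.1 p.2
    + ∑ l ∈ Finset.range (k / 2 + 1 - bar k),
        ∑ p ∈ Finset.HasAntidiagonal.antidiagonal (2 * l + bar k),
        eCoef q k p.1 p.2 • bbF q ρ p.1 p.2

end Formula

end QOnsager

end

/-! Up to an additive constant and a nonzero scalar, Δ(u) is a Sklyanin determinant: a quadratic
expression in the currents at U(u) and U(uq), central because the exchange relations degenerate at
that pair of points.

Put Q = q², x = (q²+1)U, y = (q²+1)V, add ρ/(q-q⁻¹) to both G-currents and rescale G₊. The linear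
terms disappear and the relations become homogeneous quadratic (`CurrentRel.exchangeRel`). Solving
them for the products in one order gives rules that reverse the order, at the cost of the factor
N(x,y) = (Qx-y)(x-Qy) + (Q²-1)²η² (`exchangeNorm`). For x = a²+Qb², y = Qa²+b², η = ab, one has Qx-y
= (Q²-1)b² and x-Qy = -(Q²-1)a², so N vanishes and the rules collapse to linear relations among
products in a single order (`ExchangeRel.fusionRel`). With a = qu, b = q⁻¹u⁻¹ these are the points
U(u), U(uq). Moving a current at a third point z through the determinant leaves a combination of
fusion relations, hence zero (`norm_smul_sklyaninDet_mul_w`, `norm_smul_sklyaninDet_mul_g`). The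
factors N(x,z), N(y,z) cancel because scalars are taken in the field of iterated Laurent series in
u⁻¹ and V⁻¹, where both are nonzero. This part only needs q⁴ ≠ 1, q ≠ 0 and ρ ≠ 0.

To reach these points, the defining relations are multiplied by U⁻¹V⁻¹, so that they live in power
series, and U⁻¹, V⁻¹ are replaced by expansions at u = ∞ through substitution homomorphisms
(`currentRel_powerSeries`, `currentRel_expandFst`, `currentRel_expandBoth`).

The explicit formula is a separate computation: U(tu)^{-i-1} is u^{-2i-2} times a series in u⁻⁴
whose coefficients are the w_m^i up to powers of t (`Upow_eq`). Collecting the coefficient of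
u^{-2k-2} gives c_{k+1}Δ_{k+1} (`coeff_DeltaSeries_eq`), and c_{k+1} ≠ 0 transfers centrality to
Δ_{k+1}. -/

namespace QOnsager

/-! ### Exchange relations and their degeneration -/

/-- The quadratic exchange relations between the currents at two spectral points `x`, `y`: the
relations of `𝒜_q`, after rescaling of `U` and an affine change of the currents `G_±`, in terms of
`Q = q ^ 2`. The parameter `η` (equal to `1` in the application) makes them homogeneous. -/
structure ExchangeRel {F R : Type*} [CommRing F] [Ring R] [Algebra F R] (Q η x y : F)
    (W G W' G' : Sgn → R) : Prop where
  w_comm (e : Sgn) : W e * W' e = W' e * W e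
  w_w (e : Sgn) : (x - y) • (W e * W' e.opp - W' e.opp * W e)
    = G e * G' e.opp - G' e * G e.opp
  ww_gg (e : Sgn) :
    (x - y) • (((Q - 1) ^ 2 * (Q + 1) * η) • (W e * W' e - W e.opp * W' e.opp)
        + Q • (G e * G' e.opp - G' e.opp * G e))
      + ((Q - 1) ^ 2 * ((Q + 1) ^ 2 * η ^ 2 - x * y)) • (W e * W' e.opp - W' e * W e.opp) = 0
  g_w (e : Sgn) :
    x • (Q • (G' e.opp * W e) - W e * G' e.opp) - y • (Q • (G e.opp * W' e) - W' e * G e.opp)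
      - ((Q ^ 2 - 1) * η) • (W e.opp * G' e.opp - W' e.opp * G e.opp) = 0
  w_g (e : Sgn) :
    x • (Q • (W e.opp * G' e.opp) - G' e.opp * W e.opp)
      - y • (Q • (W' e.opp * G e.opp) - G e.opp * W' e.opp)
      - ((Q ^ 2 - 1) * η) • (W e * G' e.opp - W' e * G e.opp) = 0
  g_w_comm (d e : Sgn) : G d * W' e - W' e * G d + (W e * G' d - G' d * W e) = 0
  g_comm (e : Sgn) : G e * G' e = G' e * G e

@[simp] theorem Sgn.opp_opp (e : Sgn) : e.opp.opp = e := by cases e <;> rfl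

/-- The factor that is inverted when two currents are exchanged. -/
def exchangeNorm {F : Type*} [CommRing F] (Q η x y : F) : F :=
  Q * (x ^ 2 + y ^ 2) - (Q ^ 2 + 1) * x * y + (Q ^ 2 - 1) ^ 2 * η ^ 2

namespace ExchangeRel

variable {F R : Type*} [CommRing F] [Ring R] [Algebra F R] {Q η x y : F} {W G W' G' : Sgn → R}

/-- The factor is kept although the currents commute, so that every exchange rule has the same left
coefficient. -/
theorem w_mul_w (r : ExchangeRel Q η x y W G W' G') (e : Sgn) :
    exchangeNorm Q η x y • (W e * W' e) = exchangeNorm Q η x y • (W' e * W e) := by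
  rw [r.w_comm]

theorem g_mul_g (r : ExchangeRel Q η x y W G W' G') (e : Sgn) :
    exchangeNorm Q η x y • (G e * G' e) = exchangeNorm Q η x y • (G' e * G e) := by
  rw [r.g_comm]

/-- Eliminating `G e * G' e.opp` from `ww_gg` by means of `w_w` leaves one equation for `W e * W'
e.opp`, with coefficient Q(x-y)² + (Q-1)²((Q+1)²η²-xy), which is the exchange norm. -/
theorem w_mul_w_opp (r : ExchangeRel Q η x y W G W' G') (e : Sgn) :
    exchangeNorm Q η x y • (W e * W' e.opp)
      = (Q * (x - y) ^ 2) • (W' e.opp * W e)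
        + ((Q - 1) ^ 2 * ((Q + 1) ^ 2 * η ^ 2 - x * y)) • (W' e * W e.opp)
        - ((x - y) * ((Q - 1) ^ 2 * (Q + 1) * η)) • (W' e * W e - W' e.opp * W e.opp)
        - ((x - y) * Q) • (G' e * G e.opp - G' e.opp * G e) := by
  have h1 := r.w_w e
  have h2 := r.ww_gg e
  have h3 := r.w_comm e
  have h4 := r.w_comm e.opp
  linear_combination (norm := (unfold exchangeNorm; module))
    h2 + ((x - y) * Q) • h1 - ((x - y) * ((Q - 1) ^ 2 * (Q + 1) * η)) • h3
      + ((x - y) * ((Q - 1) ^ 2 * (Q + 1) * η)) • h4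

theorem g_mul_g_opp (r : ExchangeRel Q η x y W G W' G') (e : Sgn) :
    exchangeNorm Q η x y • (G e * G' e.opp)
      = ((Q - 1) ^ 2 * ((Q + 1) ^ 2 * η ^ 2 - x * y)) • (G' e * G e.opp)
        + (Q * (x - y) ^ 2) • (G' e.opp * G e)
        - ((x - y) * ((Q - 1) ^ 2 * ((Q + 1) ^ 2 * η ^ 2 - x * y))) •
          (W' e.opp * W e - W' e * W e.opp)
        - ((x - y) ^ 2 * ((Q - 1) ^ 2 * (Q + 1) * η)) • (W' e * W e - W' e.opp * W e.opp) := by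
  have h1 := r.w_w e
  have h2 := r.w_mul_w_opp e
  linear_combination (norm := (unfold exchangeNorm; module))
    (x - y) • h2 - exchangeNorm Q η x y • h1

/-- Once `g_w_comm` removes the products `G * W'`, the relations `g_w` and `w_g` form a 2×2 linear
system in `W e * G' e` and `W e.opp * G' e` of determinant (Qy-x)(Qx-y) - (Q²-1)²η², minus the
exchange norm. Cramer's rule solves it, here and in `w_opp_mul_g`. -/
theorem w_mul_g (r : ExchangeRel Q η x y W G W' G') (e : Sgn) :
    exchangeNorm Q η x y • (W e * G' e)
      = ((Q ^ 2 - 1) ^ 2 * η ^ 2 - (Q - 1) * y * (Q * y - x)) • (W' e * G e)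
        - ((Q ^ 2 - 1) * η * (x - y)) • (W' e.opp * G e)
        - ((Q * y - x) * (x - y)) • (G' e * W e)
        + (Q * (Q ^ 2 - 1) * η * (x - y)) • (G' e * W e.opp) := by
  have h1 := r.g_w e.opp
  have h2 := r.w_g e.opp
  have h3 := r.g_w_comm e e
  have h4 := r.g_w_comm e e.opp
  simp only [Sgn.opp_opp] at *
  linear_combination (norm := (unfold exchangeNorm; module))
    -((Q ^ 2 - 1) * η) • h1 - (Q * y - x) • h2
      - ((Q ^ 2 - 1) * η * (y * Q)) • h4 + ((Q * y - x) * y) • h3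

theorem w_opp_mul_g (r : ExchangeRel Q η x y W G W' G') (e : Sgn) :
    exchangeNorm Q η x y • (W e.opp * G' e)
      = ((Q ^ 2 - 1) ^ 2 * η ^ 2 - (Q - 1) * y * (Q * x - y)) • (W' e.opp * G e)
        + (Q * (Q ^ 2 - 1) * η * (x - y)) • (W' e * G e)
        + (Q * (Q * x - y) * (x - y)) • (G' e * W e.opp)
        - ((Q ^ 2 - 1) * η * (x - y)) • (G' e * W e) := by
  have h1 := r.g_w e.opp
  have h2 := r.w_g e.opp
  have h3 := r.g_w_comm e e
  have h4 := r.g_w_comm e e.opp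
  simp only [Sgn.opp_opp] at *
  linear_combination (norm := (unfold exchangeNorm; module))
    -(Q * x - y) • h1 - ((Q ^ 2 - 1) * η) • h2
      - ((Q * x - y) * (y * Q)) • h4 + ((Q ^ 2 - 1) * η * y) • h3

theorem g_mul_w (r : ExchangeRel Q η x y W G W' G') (e : Sgn) :
    exchangeNorm Q η x y • (G e * W' e)
      = (Q * (x - y) * (x - Q * y)) • (W' e * G e)
        + ((Q ^ 2 - 1) ^ 2 * η ^ 2 - (Q - 1) * x * (Q * y - x)) • (G' e * W e)
        + ((Q ^ 2 - 1) * η * (x - y)) • (W' e.opp * G e)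
        - (Q * (Q ^ 2 - 1) * η * (x - y)) • (G' e * W e.opp) := by
  linear_combination (norm := (unfold exchangeNorm; module))
    exchangeNorm Q η x y • r.g_w_comm e e - r.w_mul_g e

theorem g_mul_w_opp (r : ExchangeRel Q η x y W G W' G') (e : Sgn) :
    exchangeNorm Q η x y • (G e * W' e.opp)
      = ((x - y) * (Q * x - y)) • (W' e.opp * G e)
        + ((Q ^ 2 - 1) ^ 2 * η ^ 2 - (Q - 1) * x * (Q * x - y)) • (G' e * W e.opp)
        - (Q * (Q ^ 2 - 1) * η * (x - y)) • (W' e * G e)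
        + ((Q ^ 2 - 1) * η * (x - y)) • (G' e * W e) := by
  linear_combination (norm := (unfold exchangeNorm; module))
    exchangeNorm Q η x y • r.g_w_comm e e.opp - r.w_opp_mul_g e

end ExchangeRel

/-- Relations between the currents at `x = a ^ 2 + Q b ^ 2` and `y = Q a ^ 2 + b ^ 2`, where
`exchangeNorm Q (a b) x y` vanishes. -/
structure FusionRel {F R : Type*} [CommRing F] [Ring R] [Algebra F R] (Q a b : F)
    (W G W' G' : Sgn → R) (e : Sgn) : Prop where
  w_w : (Q * (Q - 1) * (a ^ 2 - b ^ 2)) • (W e.opp * W' e - W e * W' e.opp)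
      - ((Q - 1) ^ 2 * (Q + 1) * (a * b)) • (W e * W' e - W e.opp * W' e.opp)
      - Q • (G e * G' e.opp - G e.opp * G' e) = 0
  g_w : b • (G e * W' e) - (Q * b) • (W e * G' e) - (Q * a) • (G e * W' e.opp)
      + a • (W e.opp * G' e) = 0

/-- The exchange relations at a zero of `exchangeNorm` imply the fusion relations. -/
theorem ExchangeRel.fusionRel {F R : Type*} [Field F] [Ring R] [Algebra F R] {Q a b : F}
    {W G W' G' : Sgn → R} (hQ : Q ^ 2 ≠ 1) (hb : b ≠ 0) (hab : a ^ 2 ≠ b ^ 2)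
    (r : ExchangeRel Q (a * b) (Q * a ^ 2 + b ^ 2) (a ^ 2 + Q * b ^ 2) W' G' W G) (e : Sgn) :
    FusionRel Q a b W G W' G' e := by
  have hQ2 : Q ^ 2 - 1 ≠ 0 := sub_ne_zero.2 hQ
  have hQ1 : Q - 1 ≠ 0 := fun h => hQ2 (by linear_combination (Q + 1) * h)
  have hd : (Q - 1) * (a ^ 2 - b ^ 2) ≠ 0 := mul_ne_zero hQ1 (sub_ne_zero.2 hab)
  constructor
  · have h := r.w_mul_w_opp e
    -- The norm is zero here and (Q+1)²η² minus the product of the two points is -Q(a²-b²)², so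
    -- every remaining coefficient is divisible by the difference (Q-1)(a²-b²) of the points.
    refine (smul_eq_zero.1 (?_ : ((Q - 1) * (a ^ 2 - b ^ 2)) • _ = (0 : R))).resolve_left hd
    linear_combination (norm := (unfold exchangeNorm; module)) -h
  · have h := r.w_mul_g e
    -- Again the left side vanishes, and the coefficients on the right share the factor (Q²-1) b
    -- (Q-1)(a²-b²).
    refine (smul_eq_zero.1
      (?_ : ((Q ^ 2 - 1) * b * ((Q - 1) * (a ^ 2 - b ^ 2))) • _ = (0 : R))).resolve_left
        (mul_ne_zero (mul_ne_zero hQ2 hb) hd)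
    linear_combination (norm := (unfold exchangeNorm; module)) h

/-- The quadratic central element (the Sklyanin determinant) of a pair of currents. -/
def sklyaninDet {F R : Type*} [CommRing F] [Ring R] [Algebra F R] (Q η x y : F)
    (W G W' G' : Sgn → R) (e : Sgn) : R :=
  (Q * (Q - 1) * (x + y)) • (W e * W' e.opp + W e.opp * W' e)
    - ((Q ^ 2 + 1) * (Q ^ 2 - 1) * η) • (W e * W' e + W e.opp * W' e.opp)
    - (Q * (Q + 1)) • (G e * G' e.opp + G e.opp * G' e)

/-! ### Centrality of the Sklyanin determinant -/

section

variable {F R : Type*} [CommRing F] [Ring R] [Algebra F R] {Q η a b x y z : F}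
  {W1 G1 W2 G2 W3 G3 : Sgn → R}

-- The current at z is moved to the left, first past the factor at y by `r₂`, then past the factor
-- at x by `r₁`. The two sides then differ by left multiples of fusion relations. The determinant is
-- symmetric in `e` and `e.opp`, so commuting with `W3 e` for arbitrary `e` covers both signs.
set_option maxHeartbeats 2000000 in
theorem norm_smul_sklyaninDet_mul_w
    (r₁ : ExchangeRel Q η x z W1 G1 W3 G3) (r₂ : ExchangeRel Q η y z W2 G2 W3 G3)
    (hη : η = a * b) (hx : x = a ^ 2 + Q * b ^ 2) (hy : y = Q * a ^ 2 + b ^ 2) (e : Sgn)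
    (f₁ : FusionRel Q a b W1 G1 W2 G2 e) (f₂ : FusionRel Q a b W1 G1 W2 G2 e.opp) :
    (exchangeNorm Q η x z * exchangeNorm Q η y z) • (sklyaninDet Q η x y W1 G1 W2 G2 e * W3 e)
      = (exchangeNorm Q η x z * exchangeNorm Q η y z) •
          (W3 e * sklyaninDet Q η x y W1 G1 W2 G2 e) := by
  -- Naming: `a` and `b` stand for the exchanges at (x,z) and (y,z); the next two letters are the
  -- currents exchanged, with `p`, `m`, `g`, `h` for `W e`, `W e.opp`, `G e`, `G e.opp`.
  have agh := r₁.g_mul_g_opp e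
  have agm := r₁.g_mul_w_opp e
  have agp := r₁.g_mul_w e
  have ahg := r₁.g_mul_g_opp e.opp
  have ahm := r₁.g_mul_w e.opp
  have ahp := r₁.g_mul_w_opp e.opp
  have amg := r₁.w_opp_mul_g e
  have amh := r₁.w_mul_g e.opp
  have amm := r₁.w_mul_w e.opp
  have amp := r₁.w_mul_w_opp e.opp
  have apg := r₁.w_mul_g e
  have aph := r₁.w_opp_mul_g e.opp
  have apm := r₁.w_mul_w_opp e
  have app := r₁.w_mul_w e
  have bgp := r₂.g_mul_w e
  have bhp := r₂.g_mul_w_opp e.opp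
  have bmp := r₂.w_mul_w_opp e.opp
  have bpp := r₂.w_mul_w e
  have f₁w := f₁.w_w
  have f₁g := f₁.g_w
  have f₂g := f₂.g_w
  simp only [Sgn.opp_opp] at *
  linear_combination (norm := skip)
    (exchangeNorm Q η x z * (-((Q ^ 2 + 1) * (Q ^ 2 - 1) * η))) • congrArg (W1 e * ·) bpp
    + (exchangeNorm Q η x z * (-((Q ^ 2 + 1) * (Q ^ 2 - 1) * η))) • congrArg (W1 e.opp * ·) bmp
    + (exchangeNorm Q η x z * (-(Q * (Q + 1)))) • congrArg (G1 e * ·) bhp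
    + (exchangeNorm Q η x z * (-(Q * (Q + 1)))) • congrArg (G1 e.opp * ·) bgp
    + (exchangeNorm Q η x z * (Q * (Q - 1) * (x + y))) • congrArg (W1 e * ·) bmp
    + (exchangeNorm Q η x z * (Q * (Q - 1) * (x + y))) • congrArg (W1 e.opp * ·) bpp
    + ((-((Q ^ 2 + 1) * (Q ^ 2 - 1) * η)) * ((exchangeNorm Q η y z)) + (Q * (Q - 1) * (x + y)) *
      (((y - z) * ((Q - 1) ^ 2 * (Q + 1) * η)))) • congrArg (· * W2 e) app
    + ((-((Q ^ 2 + 1) * (Q ^ 2 - 1) * η)) * ((Q * (y - z) ^ 2))) • congrArg (· * W2 e.opp) amp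
    + ((-((Q ^ 2 + 1) * (Q ^ 2 - 1) * η)) * (((Q - 1) ^ 2 * ((Q + 1) ^ 2 * η ^ 2 - y * z)))) •
      congrArg (· * W2 e) amm
    + ((-((Q ^ 2 + 1) * (Q ^ 2 - 1) * η)) * ((-((y - z) * ((Q - 1) ^ 2 * (Q + 1) * η))))) •
      congrArg (· * W2 e.opp) amm
    + ((-((Q ^ 2 + 1) * (Q ^ 2 - 1) * η)) * (((y - z) * ((Q - 1) ^ 2 * (Q + 1) * η))) + (Q * (Q -
      1) * (x + y)) * ((exchangeNorm Q η y z))) • congrArg (· * W2 e) amp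
    + ((-((Q ^ 2 + 1) * (Q ^ 2 - 1) * η)) * ((-((y - z) * Q)))) • congrArg (· * G2 e) amh
    + ((-((Q ^ 2 + 1) * (Q ^ 2 - 1) * η)) * (((y - z) * Q))) • congrArg (· * G2 e.opp) amg
    + ((-(Q * (Q + 1))) * (((y - z) * (Q * y - z)))) • congrArg (· * G2 e.opp) agp
    + ((-(Q * (Q + 1))) * (((Q ^ 2 - 1) ^ 2 * η ^ 2 - (Q - 1) * y * (Q * y - z)))) • congrArg (· *
      W2 e) agh
    + ((-(Q * (Q + 1))) * ((-(Q * (Q ^ 2 - 1) * η * (y - z))))) • congrArg (· * G2 e.opp) agm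
    + ((-(Q * (Q + 1))) * (((Q ^ 2 - 1) * η * (y - z)))) • congrArg (· * W2 e.opp) agh
    + ((-(Q * (Q + 1))) * ((Q * (y - z) * (y - Q * z)))) • congrArg (· * G2 e) ahp
    + ((-(Q * (Q + 1))) * (((Q ^ 2 - 1) ^ 2 * η ^ 2 - (Q - 1) * y * (Q * z - y)))) • congrArg (· *
      W2 e) ahg
    + ((-(Q * (Q + 1))) * (((Q ^ 2 - 1) * η * (y - z)))) • congrArg (· * G2 e) ahm
    + ((-(Q * (Q + 1))) * ((-(Q * (Q ^ 2 - 1) * η * (y - z))))) • congrArg (· * W2 e.opp) ahg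
    + ((Q * (Q - 1) * (x + y)) * ((Q * (y - z) ^ 2))) • congrArg (· * W2 e.opp) app
    + ((Q * (Q - 1) * (x + y)) * (((Q - 1) ^ 2 * ((Q + 1) ^ 2 * η ^ 2 - y * z)))) • congrArg (· *
      W2 e) apm
    + ((Q * (Q - 1) * (x + y)) * ((-((y - z) * ((Q - 1) ^ 2 * (Q + 1) * η))))) • congrArg (· * W2
      e.opp) apm
    + ((Q * (Q - 1) * (x + y)) * ((-((y - z) * Q)))) • congrArg (· * G2 e) aph
    + ((Q * (Q - 1) * (x + y)) * (((y - z) * Q))) • congrArg (· * G2 e.opp) apg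
    -- All words now begin with a current at z; these polynomial multiples of the fusion relations
    -- account for what is left.
    + ((Q - 1) ^ 2 * (Q + 1) * (y - z) * (Q ^ 5 * a ^ 2 * b ^ 4 - Q ^ 4 * a ^ 2 * b  ^
      2 * z - Q ^ 3 * a ^ 2 * b ^ 4 - Q ^ 3 * a ^ 2 * b ^ 2 * z + Q ^ 3 * b ^ 4 *
      z + Q ^ 2 * a ^ 4 * b ^ 2 + Q ^ 2 * a ^ 2 * z ^ 2 - Q * a ^ 4 * z + Q * a  ^
      2 * b ^ 2 * z - Q * b ^ 2 * z ^ 2 - a ^ 4 * b ^ 2 + a ^ 2 * b ^ 2 * z)) •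
      congrArg (W3 e * ·) f₁w
    + ((Q - 1) ^ 2 * (Q + 1) * (y - z) * (Q ^ 5 * a ^ 3 * b ^ 3 + Q ^ 4 * a ^ 3 * b  ^
      3 - Q ^ 4 * a * b ^ 5 - Q ^ 4 * a * b ^ 3 * z - Q ^ 3 * a ^ 3 * b * z - Q ^ 3
      * a * b ^ 5 + Q ^ 3 * a * b ^ 3 * z + Q ^ 2 * a ^ 5 * b - Q ^ 2 * a ^ 3 * b *
      z + Q ^ 2 * a * b ^ 3 * z + Q ^ 2 * a * b * z ^ 2 + Q * a ^ 5 * b - Q * a ^ 3 *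
      b ^ 3 - Q * a ^ 3 * b * z + Q * a * b ^ 3 * z - Q * a * b * z ^ 2 - a ^ 3 * b  ^
      3 + a ^ 3 * b * z)) • congrArg (W3 e.opp * ·) f₁w
    + ((Q - 1) ^ 2 * (Q + 1) * (y - z) * (-Q ^ 5 * a ^ 3 * b ^ 2 + 2 * Q ^ 5 * a * b ^ 4
      + Q ^ 4 * a * b ^ 4 - Q ^ 4 * a * b ^ 2 * z + Q ^ 3 * a ^ 3 * z - 2 * Q ^ 3 *
      a * b ^ 2 * z - Q ^ 2 * a ^ 5 + 2 * Q ^ 2 * a ^ 3 * b ^ 2 - Q ^ 2 * a * b  ^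
      2 * z + Q ^ 2 * a * z ^ 2 + Q * a ^ 3 * b ^ 2 - Q * a ^ 3 * z)) • congrArg (G3 e *
      ·) f₂g
    + ((Q - 1) ^ 2 * (Q + 1) * (y - z) * (-Q ^ 5 * a ^ 2 * b ^ 3 - 2 * Q ^ 4 * a ^ 2 * b
      ^  3 + Q ^ 4 * b ^ 5 + Q ^ 4 * b ^ 3 * z + Q ^ 3 * a ^ 2 * b * z - Q ^ 2 * a
      ^  4 * b + 2 * Q ^ 2 * a ^ 2 * b * z - Q ^ 2 * b ^ 3 * z - Q ^ 2 * b * z ^ 2 - 2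
      * Q * a ^ 4 * b + Q * a ^ 2 * b ^ 3 + Q * a ^ 2 * b * z)) • congrArg (G3 e.opp * ·)
      f₁g
  simp only [sklyaninDet, @mul_add R, @mul_sub R, @add_mul R, @sub_mul R, mul_smul_comm,
    smul_mul_assoc, @mul_assoc R, @mul_zero R]
  -- Comparing coefficients of each noncommutative word leaves polynomial identities in Q, a, b, z.
  match_scalars
  all_goals (subst hη hx hy; try unfold exchangeNorm)
  all_goals ring

set_option maxHeartbeats 2000000 in
theorem norm_smul_sklyaninDet_mul_g
    (r₁ : ExchangeRel Q η x z W1 G1 W3 G3) (r₂ : ExchangeRel Q η y z W2 G2 W3 G3)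
    (hη : η = a * b) (hx : x = a ^ 2 + Q * b ^ 2) (hy : y = Q * a ^ 2 + b ^ 2) (e : Sgn)
    (f₁ : FusionRel Q a b W1 G1 W2 G2 e) (f₂ : FusionRel Q a b W1 G1 W2 G2 e.opp) :
    (exchangeNorm Q η x z * exchangeNorm Q η y z) • (sklyaninDet Q η x y W1 G1 W2 G2 e * G3 e)
      = (exchangeNorm Q η x z * exchangeNorm Q η y z) •
          (G3 e * sklyaninDet Q η x y W1 G1 W2 G2 e) := by
  have agg := r₁.g_mul_g e
  have agh := r₁.g_mul_g_opp e
  have agm := r₁.g_mul_w_opp e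
  have agp := r₁.g_mul_w e
  have ahg := r₁.g_mul_g_opp e.opp
  have amg := r₁.w_opp_mul_g e
  have amm := r₁.w_mul_w e.opp
  have amp := r₁.w_mul_w_opp e.opp
  have apg := r₁.w_mul_g e
  have apm := r₁.w_mul_w_opp e
  have app := r₁.w_mul_w e
  have bgg := r₂.g_mul_g e
  have bhg := r₂.g_mul_g_opp e.opp
  have bmg := r₂.w_opp_mul_g e
  have bpg := r₂.w_mul_g e
  have f₁w := f₁.w_w
  have f₁g := f₁.g_w
  have f₂g := f₂.g_w
  simp only [Sgn.opp_opp] at *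
  linear_combination (norm := skip)
    (exchangeNorm Q η x z * (-((Q ^ 2 + 1) * (Q ^ 2 - 1) * η))) • congrArg (W1 e * ·) bpg
    + (exchangeNorm Q η x z * (-((Q ^ 2 + 1) * (Q ^ 2 - 1) * η))) • congrArg (W1 e.opp * ·) bmg
    + (exchangeNorm Q η x z * (-(Q * (Q + 1)))) • congrArg (G1 e * ·) bhg
    + (exchangeNorm Q η x z * (-(Q * (Q + 1)))) • congrArg (G1 e.opp * ·) bgg
    + (exchangeNorm Q η x z * (Q * (Q - 1) * (x + y))) • congrArg (W1 e * ·) bmg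
    + (exchangeNorm Q η x z * (Q * (Q - 1) * (x + y))) • congrArg (W1 e.opp * ·) bpg
    + ((-((Q ^ 2 + 1) * (Q ^ 2 - 1) * η)) * (((Q ^ 2 - 1) ^ 2 * η ^ 2 - (Q - 1) * z * (Q * z -
      y))) + (Q * (Q - 1) * (x + y)) * ((Q * (Q ^ 2 - 1) * η * (y - z)))) • congrArg (· * G2 e)
      app
    + ((-((Q ^ 2 + 1) * (Q ^ 2 - 1) * η)) * ((-((Q ^ 2 - 1) * η * (y - z)))) + (Q * (Q - 1) * (x +
      y)) * (((Q ^ 2 - 1) ^ 2 * η ^ 2 - (Q - 1) * z * (Q * y - z)))) • congrArg (· * G2 e) apm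
    + ((-((Q ^ 2 + 1) * (Q ^ 2 - 1) * η)) * ((-((Q * z - y) * (y - z)))) + (Q * (Q - 1) * (x + y))
      * ((-((Q ^ 2 - 1) * η * (y - z))))) • congrArg (· * W2 e) apg
    + ((-((Q ^ 2 + 1) * (Q ^ 2 - 1) * η)) * ((Q * (Q ^ 2 - 1) * η * (y - z))) + (Q * (Q - 1) * (x
      + y)) * ((Q * (Q * y - z) * (y - z)))) • congrArg (· * W2 e.opp) apg
    + ((-((Q ^ 2 + 1) * (Q ^ 2 - 1) * η)) * (((Q ^ 2 - 1) ^ 2 * η ^ 2 - (Q - 1) * z * (Q * y -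
      z))) + (Q * (Q - 1) * (x + y)) * ((-((Q ^ 2 - 1) * η * (y - z))))) • congrArg (· * G2 e) amm
    + ((-((Q ^ 2 + 1) * (Q ^ 2 - 1) * η)) * ((Q * (Q ^ 2 - 1) * η * (y - z))) + (Q * (Q - 1) * (x
      + y)) * (((Q ^ 2 - 1) ^ 2 * η ^ 2 - (Q - 1) * z * (Q * z - y)))) • congrArg (· * G2 e) amp
    + ((-((Q ^ 2 + 1) * (Q ^ 2 - 1) * η)) * ((Q * (Q * y - z) * (y - z))) + (Q * (Q - 1) * (x +
      y)) * ((Q * (Q ^ 2 - 1) * η * (y - z)))) • congrArg (· * W2 e.opp) amg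
    + ((-((Q ^ 2 + 1) * (Q ^ 2 - 1) * η)) * ((-((Q ^ 2 - 1) * η * (y - z)))) + (Q * (Q - 1) * (x +
      y)) * ((-((Q * z - y) * (y - z))))) • congrArg (· * W2 e) amg
    + ((-(Q * (Q + 1))) * (((Q - 1) ^ 2 * ((Q + 1) ^ 2 * η ^ 2 - y * z)))) • congrArg (· * G2 e)
      agh
    + ((-(Q * (Q + 1))) * ((Q * (y - z) ^ 2))) • congrArg (· * G2 e.opp) agg
    + ((-(Q * (Q + 1))) * ((-((y - z) * ((Q - 1) ^ 2 * ((Q + 1) ^ 2 * η ^ 2 - y * z)))))) •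
      congrArg (· * W2 e.opp) agp
    + ((-(Q * (Q + 1))) * (((y - z) * ((Q - 1) ^ 2 * ((Q + 1) ^ 2 * η ^ 2 - y * z))))) • congrArg
      (· * W2 e) agm
    + ((-(Q * (Q + 1))) * ((-((y - z) ^ 2 * ((Q - 1) ^ 2 * (Q + 1) * η))))) • congrArg (· * W2
      e.opp) agm
    + ((-(Q * (Q + 1))) * (((y - z) ^ 2 * ((Q - 1) ^ 2 * (Q + 1) * η)))) • congrArg (· * W2 e) agp
    + ((-(Q * (Q + 1))) * ((exchangeNorm Q η y z))) • congrArg (· * G2 e) ahg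
    + ((Q - 1) ^ 3 * (Q + 1) * (y - z) * (2 * Q ^ 6 * a ^ 3 * b ^ 4 + 3 * Q ^ 5 * a ^ 3
      * b ^ 4 - Q ^ 5 * a ^ 3 * b ^ 2 * z + Q ^ 4 * a ^ 3 * b ^ 4 - 2 * Q ^ 4 * a
      ^  3 * b ^ 2 * z - Q ^ 4 * a * b ^ 6 - Q ^ 4 * a * b ^ 2 * z ^ 2 + 2 * Q ^ 3 *
      a ^ 5 * b ^ 2 - 3 * Q ^ 3 * a ^ 3 * b ^ 2 * z + Q ^ 3 * a ^ 3 * z ^ 2 - Q  ^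
      3 * a * b ^ 6 + Q ^ 3 * a * b ^ 4 * z + 3 * Q ^ 2 * a ^ 5 * b ^ 2 - Q ^ 2 * a
      ^  5 * z - Q ^ 2 * a ^ 3 * b ^ 2 * z + Q ^ 2 * a * b ^ 4 * z + Q ^ 2 * a * z  ^
      3 + Q * a ^ 5 * b ^ 2 - Q * a ^ 3 * b ^ 4 - Q * a ^ 3 * z ^ 2 + Q * a * b ^ 4
      * z - Q * a * b ^ 2 * z ^ 2 - a ^ 3 * b ^ 4 + a ^ 3 * b ^ 2 * z)) • congrArg (W3
      e * ·) f₁g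
    + ((Q - 1) ^ 3 * (Q + 1) * (y - z) * (Q ^ 6 * a ^ 4 * b ^ 3 + Q ^ 5 * a ^ 4 * b  ^
      3 - Q ^ 5 * a ^ 2 * b ^ 5 - Q ^ 5 * a ^ 2 * b ^ 3 * z - Q ^ 4 * a ^ 4 * b *
      z - 3 * Q ^ 4 * a ^ 2 * b ^ 5 + Q ^ 3 * a ^ 6 * b - Q ^ 3 * a ^ 4 * b * z - 2
      * Q ^ 3 * a ^ 2 * b ^ 5 + Q ^ 3 * a ^ 2 * b ^ 3 * z + Q ^ 3 * a ^ 2 * b * z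
      ^  2 + Q ^ 3 * b ^ 5 * z + Q ^ 3 * b ^ 3 * z ^ 2 + Q ^ 2 * a ^ 6 * b - Q ^ 2
      * a ^ 4 * b ^ 3 - Q ^ 2 * a ^ 4 * b * z + 3 * Q ^ 2 * a ^ 2 * b ^ 3 * z - 3 *
      Q * a ^ 4 * b ^ 3 + 2 * Q * a ^ 2 * b ^ 3 * z - Q * b ^ 3 * z ^ 2 - Q * b * z  ^
      3 - 2 * a ^ 4 * b ^ 3 + a ^ 2 * b ^ 3 * z + a ^ 2 * b * z ^ 2)) • congrArg (W3
      e.opp * ·) f₁g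
    + ((Q - 1) ^ 2 * (Q + 1) * (y - z) * (-Q ^ 5 * a ^ 2 * b ^ 4 - 2 * Q ^ 4 * a ^ 2 * b
      ^  4 + Q ^ 4 * a ^ 2 * b ^ 2 * z - Q ^ 3 * a ^ 2 * b ^ 4 + Q ^ 3 * a ^ 2 * b
      ^  2 * z + Q ^ 3 * b ^ 4 * z - Q ^ 2 * a ^ 4 * b ^ 2 + 2 * Q ^ 2 * a ^ 2 * b
      ^  2 * z - Q ^ 2 * a ^ 2 * z ^ 2 - 2 * Q * a ^ 4 * b ^ 2 + Q * a ^ 4 * z + Q * a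
      ^  2 * b ^ 2 * z - Q * b ^ 2 * z ^ 2 - a ^ 4 * b ^ 2 + a ^ 2 * b ^ 2 * z)) •
      congrArg (G3 e * ·) f₁w
  simp only [sklyaninDet, @mul_add R, @mul_sub R, @add_mul R, @sub_mul R, mul_smul_comm,
    smul_mul_assoc, @mul_assoc R, @mul_zero R]
  match_scalars
  all_goals (subst hη hx hy; try unfold exchangeNorm)
  all_goals ring

end

/-! ### Substitution into power series over a noncommutative ring -/

section Substitution

open PowerSeries

variable {K : Type*} [Field K] {R T : Type*} [Ring R] [Ring T] [Algebra K R] [Algebra K T]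

theorem coeff_mul_pow_eq_zero {σ : PowerSeries T} (hσ : constantCoeff σ = 0)
    (f : PowerSeries T) {n k : ℕ} (h : n < k) : coeff n (f * σ ^ k) = 0 := by
  apply coeff_of_lt_order
  calc (n : ℕ∞) < k := by exact_mod_cast h
    _ ≤ order (σ ^ k) := le_order_pow_of_constantCoeff_eq_zero k hσ
    _ ≤ order f + order (σ ^ k) := le_add_self
    _ ≤ order (f * σ ^ k) := le_order_mul _ _

theorem coeff_eval₂_eq_zero (φ : R →+* PowerSeries T) {σ : PowerSeries T}
    (hσ : constantCoeff σ = 0) (p : Polynomial R) (n : ℕ) (hp : ∀ k ≤ n, p.coeff k = 0) :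
    coeff n (p.eval₂ φ σ) = 0 := by
  rw [Polynomial.eval₂_eq_sum_range, map_sum]
  refine Finset.sum_eq_zero fun k _ => ?_
  rcases le_or_gt k n with h | h
  · simp [hp k h]
  · exact coeff_mul_pow_eq_zero hσ _ h

/-- The substitution `∑ aₖ Xᵏ ↦ ∑ φ(aₖ) σᵏ`, as a function. -/
noncomputable def substFun (φ : R →+* PowerSeries T) (σ : PowerSeries T) (f : PowerSeries R) : PowerSeries T :=
  PowerSeries.mk fun n => coeff n ((trunc (n + 1) f).eval₂ φ σ)

/-- Since σ has no constant term, terms of degree above n do not reach the n-th coefficient, so any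
polynomial agreeing with f up to degree n may replace its truncation. This reduces the homomorphism
laws to those of polynomial evaluation. -/
theorem coeff_substFun (φ : R →+* PowerSeries T) {σ : PowerSeries T}
    (hσ : constantCoeff σ = 0) (f : PowerSeries R) (n : ℕ) (p : Polynomial R)
    (hp : ∀ k ≤ n, p.coeff k = coeff k f) :
    coeff n (substFun φ σ f) = coeff n (p.eval₂ φ σ) := by
  rw [substFun, coeff_mk, ← sub_eq_zero, ← map_sub, ← Polynomial.eval₂_sub]
  refine coeff_eval₂_eq_zero φ hσ _ n fun k hk => ?_
  rw [Polynomial.coeff_sub, coeff_trunc, if_pos (Nat.lt_succ_of_le hk), hp k hk, sub_self]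

theorem coeff_substFun_eq_sum (φ : R →+* PowerSeries T) (σ : PowerSeries T)
    (f : PowerSeries R) (n : ℕ) :
    coeff n (substFun φ σ f) = ∑ k ∈ Finset.range (n + 1), coeff n (φ (coeff k f) * σ ^ k) := by
  rw [substFun, coeff_mk, eval₂_trunc_eq_sum_range, map_sum]

/-- The substitution `∑ aₖ Xᵏ ↦ ∑ φ(aₖ) σᵏ` for a central `σ` without constant term. -/
noncomputable def substHom (φ : R →ₐ[K] PowerSeries T) (σ : PowerSeries T) (hσ : constantCoeff σ = 0)
    (hc : ∀ f, Commute f σ) : PowerSeries R →ₐ[K] PowerSeries T where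
  toFun := substFun (φ : R →+* PowerSeries T) σ
  map_one' := by
    ext n
    rw [coeff_substFun _ hσ _ n 1 fun k _ => by
      rw [Polynomial.coeff_one, PowerSeries.coeff_one]]
    simp
  map_mul' f g := by
    ext n
    have ht : ∀ (h : PowerSeries R), ∀ k ≤ n, (trunc (n + 1) h).coeff k = coeff k h :=
      fun h k hk => by rw [coeff_trunc, if_pos (Nat.lt_succ_of_le hk)]
    -- The product of the truncations is not the truncation of f g, but it agrees with f g up to
    -- degree n.
    rw [coeff_substFun _ hσ _ n (trunc (n + 1) f * trunc (n + 1) g),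
      Polynomial.eval₂_mul_noncomm _ _ fun k => hc _, PowerSeries.coeff_mul, PowerSeries.coeff_mul]
    · refine Finset.sum_congr rfl fun p hp => ?_
      have hp' := Finset.HasAntidiagonal.mem_antidiagonal.1 hp
      rw [coeff_substFun _ hσ f p.1 (trunc (n + 1) f) fun k hk => ht f k (by omega),
        coeff_substFun _ hσ g p.2 (trunc (n + 1) g) fun k hk => ht g k (by omega)]
    · intro k hk
      rw [Polynomial.coeff_mul, PowerSeries.coeff_mul]
      refine Finset.sum_congr rfl fun p hp => ?_
      have hp' := Finset.HasAntidiagonal.mem_antidiagonal.1 hp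
      rw [ht f _ (by omega), ht g _ (by omega)]
  map_zero' := by ext n; simp [coeff_substFun_eq_sum]
  map_add' f g := by ext n; simp [coeff_substFun_eq_sum, add_mul, Finset.sum_add_distrib]
  commutes' r := by
    ext n
    rw [coeff_substFun _ hσ _ n (Polynomial.C (algebraMap K R r)) fun k _ => by
      rw [Polynomial.coeff_C, PowerSeries.algebraMap_apply, PowerSeries.coeff_C]]
    simp

theorem coeff_substHom (φ : R →ₐ[K] PowerSeries T) (σ : PowerSeries T)
    (hσ : constantCoeff σ = 0) (hc : ∀ f, Commute f σ) (f : PowerSeries R) (n : ℕ) :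
    coeff n (substHom φ σ hσ hc f)
      = ∑ k ∈ Finset.range (n + 1), coeff n (φ (coeff k f) * σ ^ k) :=
  coeff_substFun_eq_sum _ _ _ _

theorem substHom_X (φ : R →ₐ[K] PowerSeries T) (σ : PowerSeries T)
    (hσ : constantCoeff σ = 0) (hc : ∀ f, Commute f σ) :
    substHom φ σ hσ hc X = σ := by
  ext n
  change coeff n (substFun _ σ X) = _
  rw [coeff_substFun _ hσ _ n Polynomial.X fun k _ => by
    rw [Polynomial.coeff_X, PowerSeries.coeff_X]; simp only [eq_comm]]
  simp

theorem substHom_C (φ : R →ₐ[K] PowerSeries T) (σ : PowerSeries T)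
    (hσ : constantCoeff σ = 0) (hc : ∀ f, Commute f σ) (r : R) :
    substHom φ σ hσ hc (C r) = φ r := by
  ext n
  change coeff n (substFun _ σ (C r)) = _
  rw [coeff_substFun _ hσ _ n (Polynomial.C r) fun k _ => by
    rw [Polynomial.coeff_C, PowerSeries.coeff_C]]
  simp

end Substitution

/-! ### The defining relations with denominators cleared -/

/-- The defining relations of `𝒜_q` between currents at `U = s⁻¹` and `V = t⁻¹`, multiplied by
`s t`. -/
structure CurrentRel {K R : Type*} [Field K] [Ring R] [Algebra K R] (q ρ : K) (s t : R)
    (W G W' G' : Sgn → R) : Prop where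
  w_comm (e : Sgn) : W e * W' e - W' e * W e = 0
  w_w (e : Sgn) : (t - s) * (W e * W' e.opp - W' e.opp * W e)
    = s * t * (((q - q⁻¹) / (ρ * (q + q⁻¹))) • (G e * G' e.opp - G' e * G e.opp)
        + (1 / (q + q⁻¹)) • (G e - G e.opp + G' e.opp - G' e))
  ww_gg (e : Sgn) : (t - s) * (W e * W' e - W e.opp * W' e.opp
      + (1 / (ρ * (q ^ 2 - q⁻¹ ^ 2))) • (G e * G' e.opp - G' e.opp * G e))
    + (s * t - 1) * (W e * W' e.opp - W' e * W e.opp) = 0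
  g_w (e : Sgn) : t * qComm q (G' e.opp) (W e) - s * qComm q (G e.opp) (W' e)
    - (q - q⁻¹) • (s * t * (W e.opp * G' e.opp) - s * t * (W' e.opp * G e.opp))
    + ρ • (t * W e - s * W' e - s * t * W e.opp + s * t * W' e.opp) = 0
  w_g (e : Sgn) : t * qComm q (W e.opp) (G' e.opp) - s * qComm q (W' e.opp) (G e.opp)
    - (q - q⁻¹) • (s * t * (W e * G' e.opp) - s * t * (W' e * G e.opp))
    + ρ • (t * W e.opp - s * W' e.opp - s * t * W e + s * t * W' e) = 0
  g_w_comm (d e : Sgn) : G d * W' e - W' e * G d + (W e * G' d - G' d * W e) = 0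
  g_comm (e : Sgn) : G e * G' e - G' e * G e = 0

namespace CurrentRel

variable {K R S : Type*} [Field K] [Ring R] [Algebra K R] [Ring S] [Algebra K S] {q ρ : K}
  {s t : R} {W G W' G' : Sgn → R}

theorem map (f : R →ₐ[K] S) (r : CurrentRel q ρ s t W G W' G') :
    CurrentRel q ρ (f s) (f t) (f ∘ W) (f ∘ G) (f ∘ W') (f ∘ G') where
  w_comm e := by simpa using congrArg f (r.w_comm e)
  w_w e := by simpa using congrArg f (r.w_w e)
  ww_gg e := by simpa using congrArg f (r.ww_gg e)
  g_w e := by simpa [qComm] using congrArg f (r.g_w e)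
  w_g e := by simpa [qComm] using congrArg f (r.w_g e)
  g_w_comm d e := by simpa using congrArg f (r.g_w_comm d e)
  g_comm e := by simpa using congrArg f (r.g_comm e)

/-- Used to descend from Laurent series to the power series inside them. -/
theorem of_map (f : R →ₐ[K] S) (hf : Function.Injective f)
    (r : CurrentRel q ρ (f s) (f t) (f ∘ W) (f ∘ G) (f ∘ W') (f ∘ G')) :
    CurrentRel q ρ s t W G W' G' where
  w_comm e := hf (by simpa using r.w_comm e)
  w_w e := hf (by simpa using r.w_w e)
  ww_gg e := hf (by simpa using r.ww_gg e)
  g_w e := hf (by simpa [qComm] using r.g_w e)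
  w_g e := hf (by simpa [qComm] using r.w_g e)
  g_w_comm d e := hf (by simpa using r.g_w_comm d e)
  g_comm e := hf (by simpa using r.g_comm e)

/-- The relations with denominators cleared follow from the original ones. -/
theorem of_inv {U V : R} (hst : Commute s t) (hU : s * U = 1) (hV : t * V = 1)
    (w_comm : ∀ e, W e * W' e - W' e * W e = 0)
    (w_w : ∀ e, (U - V) * (W e * W' e.opp - W' e.opp * W e)
      = ((q - q⁻¹) / (ρ * (q + q⁻¹))) • (G e * G' e.opp - G' e * G e.opp)
        + (1 / (q + q⁻¹)) • (G e - G e.opp + G' e.opp - G' e))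
    (ww_gg : ∀ e, (U - V) * (W e * W' e - W e.opp * W' e.opp
        + (1 / (ρ * (q ^ 2 - q⁻¹ ^ 2))) • (G e * G' e.opp - G' e.opp * G e))
      + (1 - U * V) * (W e * W' e.opp - W' e * W e.opp) = 0)
    (g_w : ∀ e, U * qComm q (G' e.opp) (W e) - V * qComm q (G e.opp) (W' e)
      - (q - q⁻¹) • (W e.opp * G' e.opp - W' e.opp * G e.opp)
      + ρ • (U * W e - V * W' e - W e.opp + W' e.opp) = 0)
    (w_g : ∀ e, U * qComm q (W e.opp) (G' e.opp) - V * qComm q (W' e.opp) (G e.opp)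
      - (q - q⁻¹) • (W e * G' e.opp - W' e * G e.opp)
      + ρ • (U * W e.opp - V * W' e.opp - W e + W' e) = 0)
    (g_w_comm : ∀ d e, G d * W' e - W' e * G d + (W e * G' d - G' d * W e) = 0)
    (g_comm : ∀ e, G e * G' e - G' e * G e = 0) : CurrentRel q ρ s t W G W' G' := by
  have hU' : s * t * U = t := by rw [hst.eq, mul_assoc, hU, mul_one]
  have hV' : s * t * V = s := by rw [mul_assoc, hV, mul_one]
  have hVU : s * t * (U * V) = 1 := by rw [← mul_assoc, hU', hV]
  have hd : s * t * (U - V) = t - s := by rw [mul_sub, hU', hV']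
  have hp : s * t * (1 - U * V) = s * t - 1 := by rw [mul_sub, hVU, mul_one]
  have hUx : ∀ x, s * t * (U * x) = t * x := fun x => by rw [← mul_assoc, hU']
  have hVx : ∀ x, s * t * (V * x) = s * x := fun x => by rw [← mul_assoc, hV']
  refine ⟨w_comm, fun e => ?_, fun e => ?_, fun e => ?_, fun e => ?_, g_w_comm, g_comm⟩
  · rw [← hd, mul_assoc, w_w]
  · rw [← hd, ← hp, mul_assoc, mul_assoc (s * t), ← mul_add, ww_gg, mul_zero]
  · have h := congrArg (s * t * ·) (g_w e)
    simp only [mul_add, mul_sub, mul_smul_comm, hUx, hVx, mul_zero] at h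
    rw [← h]
  · have h := congrArg (s * t * ·) (w_g e)
    simp only [mul_add, mul_sub, mul_smul_comm, hUx, hVx, mul_zero] at h
    rw [← h]

end CurrentRel

/-! ### Coefficientwise maps and power series inside Laurent series -/

section Maps

variable {K A B : Type*} [Field K] [Ring A] [Algebra K A] [Ring B] [Algebra K B]

/-- The coefficientwise map of Laurent series. -/
noncomputable def laurentMap (f : A →ₐ[K] B) : LaurentSeries A →ₐ[K] LaurentSeries B where
  toFun x := x.map f
  map_one' := HahnSeries.map_one (f : A →+* B).toMonoidWithZeroHom
  map_mul' x y := HahnSeries.map_mul (f : A →ₙ+* B)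
  map_zero' := by ext; simp
  map_add' x y := HahnSeries.map_add (f : A →+ B)
  commutes' r := by
    rw [HahnSeries.algebraMap_apply, HahnSeries.algebraMap_apply]
    change (HahnSeries.C (algebraMap K A r)).map (f : A →+* B) = _
    rw [HahnSeries.map_C]
    simp

@[simp] theorem coeff_laurentMap (f : A →ₐ[K] B) (x : LaurentSeries A) (n : ℤ) :
    (laurentMap f x).coeff n = f (x.coeff n) := rfl

@[simp] theorem laurentMap_single (f : A →ₐ[K] B) (n : ℤ) (a : A) :
    laurentMap f (HahnSeries.single n a) = HahnSeries.single n (f a) := by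
  ext m
  by_cases h : m = n <;> simp [h]

@[simp] theorem laurentMap_C (f : A →ₐ[K] B) (a : A) :
    laurentMap f (HahnSeries.C a) = HahnSeries.C (f a) := laurentMap_single f 0 a

theorem coeff_ofPowerSeries (f : PowerSeries A) (n : ℤ) :
    (HahnSeries.ofPowerSeries ℤ A f).coeff n
      = if 0 ≤ n then PowerSeries.coeff n.toNat f else 0 := by
  split_ifs with h
  · lift n to ℕ using h
    exact HahnSeries.ofPowerSeries_apply_coeff f n
  · rw [HahnSeries.ofPowerSeries_apply, HahnSeries.embDomain_of_notMem_range]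
    rintro ⟨m, rfl⟩
    exact h (by simp)

theorem laurentMap_ofPowerSeries (f : A →ₐ[K] B) (x : PowerSeries A) :
    laurentMap f (HahnSeries.ofPowerSeries ℤ A x)
      = HahnSeries.ofPowerSeries ℤ B (PowerSeries.map f x) := by
  ext n
  simp only [coeff_laurentMap, coeff_ofPowerSeries]
  split_ifs <;> simp

/-- The coefficientwise map of Laurent series in two variables. -/
noncomputable def biMap (f : A →ₐ[K] B) : BiSeries A →ₐ[K] BiSeries B := laurentMap (laurentMap f)

theorem biCoeff_biMap (f : A →ₐ[K] B) (x : BiSeries A) (m n : ℤ) :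
    biCoeff (biMap f x) m n = f (biCoeff x m n) := rfl

theorem BiSeries.ext_biCoeff {x y : BiSeries A} (h : ∀ m n, biCoeff x m n = biCoeff y m n) :
    x = y := by
  ext n m
  exact h m n

@[simp] theorem biMap_serU (f : A →ₐ[K] B) : biMap f serU = serU := by
  simp [biMap, serU]

@[simp] theorem biMap_serV (f : A →ₐ[K] B) : biMap f serV = serV := by
  simp [biMap, serV]

@[simp] theorem biMap_atU (f : A →ₐ[K] B) (a : ℕ → A) :
    biMap f (atU a) = atU (fun k => f (a k)) := by
  rw [biMap, atU, laurentMap_C, map_mul, laurentMap_ofPowerSeries, laurentMap_single, map_one, atU]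
  congr 3

@[simp] theorem biMap_atV (f : A →ₐ[K] B) (a : ℕ → A) :
    biMap f (atV a) = atV (fun k => f (a k)) := by
  rw [biMap, atV, map_mul, laurentMap_ofPowerSeries, laurentMap_single, map_one, atV]
  congr 2
  ext n
  simp

theorem biMap_C (f : A →ₐ[K] B) (x : LaurentSeries A) :
    biMap f (HahnSeries.C x) = HahnSeries.C (laurentMap f x) := laurentMap_C _ _

theorem biMap_single_one (f : A →ₐ[K] B) (n : ℤ) :
    biMap f (HahnSeries.single n 1) = HahnSeries.single n 1 := by
  rw [biMap, laurentMap_single, map_one]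

/-- The embedding of power series in `s`, `t` into Laurent series in `s = U⁻¹`, `t = V⁻¹`. -/
noncomputable def biEmb (K : Type*) [Field K] (A : Type*) [Ring A] [Algebra K A] :
    PowerSeries (PowerSeries A) →ₐ[K] BiSeries A :=
  (HahnSeries.ofPowerSeriesAlg ℤ K (A := LaurentSeries A)).comp
    (PowerSeries.mapAlgHom (HahnSeries.ofPowerSeriesAlg ℤ K (A := A)))

theorem biEmb_apply (x : PowerSeries (PowerSeries A)) :
    biEmb K A x = HahnSeries.ofPowerSeries ℤ (LaurentSeries A)
      (PowerSeries.map (HahnSeries.ofPowerSeries ℤ A) x) := by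
  rw [biEmb, AlgHom.comp_apply, PowerSeries.mapAlgHom_apply]
  rfl

theorem biEmb_injective : Function.Injective (biEmb K A) := by
  intro x y h
  rw [biEmb_apply, biEmb_apply] at h
  exact PowerSeries.map_injective _ HahnSeries.ofPowerSeries_injective
    (HahnSeries.ofPowerSeries_injective h)

@[simp] theorem biEmb_X : biEmb K A PowerSeries.X = HahnSeries.single 1 1 := by
  simp [biEmb_apply]

@[simp] theorem biEmb_C (f : PowerSeries A) :
    biEmb K A (PowerSeries.C f) = HahnSeries.C (HahnSeries.ofPowerSeries ℤ A f) := by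
  simp [biEmb_apply]

/-- The power series `∑ aₖ X ^ (k + 1)`. -/
noncomputable def powerCurrent (a : ℕ → A) : PowerSeries A := PowerSeries.X * PowerSeries.mk a

theorem biEmb_C_powerCurrent (a : ℕ → A) :
    biEmb K A (PowerSeries.C (powerCurrent a)) = atU a := by
  rw [biEmb_C, powerCurrent, map_mul, HahnSeries.ofPowerSeries_X, atU]

theorem biEmb_map_C_powerCurrent (a : ℕ → A) :
    biEmb K A (PowerSeries.map PowerSeries.C (powerCurrent a)) = atV a := by
  rw [biEmb_apply, powerCurrent, map_mul, map_mul, map_mul, PowerSeries.map_X, PowerSeries.map_X,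
    HahnSeries.ofPowerSeries_X, atV]
  congr 2
  ext n
  simp

end Maps

/-! ### The defining relations for the currents of `Aq` -/

section Transfer

variable {K : Type*} [Field K] {q ρ : K}

/-- The quotient map onto `𝒜_q`. -/
noncomputable def aqMk (q ρ : K) : FreeAlgebra K Gen →ₐ[K] Aq q ρ := RingQuot.mkAlgHom K (Rel q ρ)

theorem biMap_eq_of_seriesRel {f g : BiSeries (FreeAlgebra K Gen)} (h : SeriesRel q ρ f g) :
    biMap (aqMk q ρ) f = biMap (aqMk q ρ) g := by
  apply BiSeries.ext_biCoeff
  intro m n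
  rw [biCoeff_biMap, biCoeff_biMap]
  exact RingQuot.mkAlgHom_rel K ⟨f, g, m, n, h, rfl, rfl⟩

theorem biMap_Wu (e : Sgn) : biMap (aqMk q ρ) (Wu K e) = atU (Wgen q ρ e) := biMap_atU _ _
theorem biMap_Wv (e : Sgn) : biMap (aqMk q ρ) (Wv K e) = atV (Wgen q ρ e) := biMap_atV _ _
theorem biMap_Gu (e : Sgn) : biMap (aqMk q ρ) (Gu K e) = atU (Ggen q ρ e) := biMap_atU _ _
theorem biMap_Gv (e : Sgn) : biMap (aqMk q ρ) (Gv K e) = atV (Ggen q ρ e) := biMap_atV _ _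

theorem currentRel_atU_atV (q ρ : K) :
    CurrentRel q ρ (HahnSeries.C (HahnSeries.single 1 1) : BiSeries (Aq q ρ))
      (HahnSeries.single 1 1) (fun e => atU (Wgen q ρ e)) (fun e => atU (Ggen q ρ e))
      (fun e => atV (Wgen q ρ e)) (fun e => atV (Ggen q ρ e)) := by
  have hst : Commute (HahnSeries.C (HahnSeries.single 1 1) : BiSeries (Aq q ρ))
      (HahnSeries.single 1 1) := by
    ext m n
    simp
  refine CurrentRel.of_inv (U := serU) (V := serV) hst ?_ ?_ (fun e => ?_) (fun e => ?_)
    (fun e => ?_) (fun e => ?_) (fun e => ?_) (fun d e => ?_) (fun e => ?_)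
  · rw [serU, ← map_mul, HahnSeries.single_mul_single]
    simp
  · rw [serV, HahnSeries.single_mul_single]
    simp
  · simpa [Ring.lie_def, biMap_Wu, biMap_Wv] using
      biMap_eq_of_seriesRel (SeriesRel.w_comm (q := q) (ρ := ρ) e)
  · have h := biMap_eq_of_seriesRel (SeriesRel.w_w (q := q) (ρ := ρ) e)
    simp only [Ring.lie_def, map_mul, map_sub, map_add, map_smul, biMap_serU, biMap_serV, biMap_Wu,
      biMap_Wv, biMap_Gu, biMap_Gv] at h
    exact h
  · have h := biMap_eq_of_seriesRel (SeriesRel.ww_gg (q := q) (ρ := ρ) e)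
    simp only [Ring.lie_def, map_mul, map_sub, map_add, map_smul, biMap_serU, biMap_serV, biMap_Wu,
      biMap_Wv, biMap_Gu, biMap_Gv, map_one, map_zero] at h
    exact h
  · have h := biMap_eq_of_seriesRel (SeriesRel.g_w (q := q) (ρ := ρ) e)
    simp only [qComm, map_mul, map_sub, map_add, map_smul, biMap_serU, biMap_serV, biMap_Wu,
      biMap_Wv, biMap_Gu, biMap_Gv, map_zero] at h
    exact h
  · have h := biMap_eq_of_seriesRel (SeriesRel.w_g (q := q) (ρ := ρ) e)
    simp only [qComm, map_mul, map_sub, map_add, map_smul, biMap_serU, biMap_serV, biMap_Wu,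
      biMap_Wv, biMap_Gu, biMap_Gv, map_zero] at h
    exact h
  · simpa [Ring.lie_def, biMap_Wu, biMap_Wv, biMap_Gu, biMap_Gv] using
      biMap_eq_of_seriesRel (SeriesRel.g_w_comm (q := q) (ρ := ρ) d e)
  · simpa [Ring.lie_def, biMap_Gu, biMap_Gv] using
      biMap_eq_of_seriesRel (SeriesRel.g_comm (q := q) (ρ := ρ) e)

/-- With denominators cleared, only nonnegative powers of U⁻¹ and V⁻¹ occur, so the Laurent
identities come from power series. There both variables can be replaced by series without constant
term. -/
theorem currentRel_powerSeries (q ρ : K) :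
    CurrentRel q ρ (PowerSeries.C PowerSeries.X : PowerSeries (PowerSeries (Aq q ρ)))
      PowerSeries.X (fun e => PowerSeries.C (powerCurrent (Wgen q ρ e)))
      (fun e => PowerSeries.C (powerCurrent (Ggen q ρ e)))
      (fun e => PowerSeries.map PowerSeries.C (powerCurrent (Wgen q ρ e)))
      (fun e => PowerSeries.map PowerSeries.C (powerCurrent (Ggen q ρ e))) := by
  refine CurrentRel.of_map (biEmb K (Aq q ρ)) biEmb_injective ?_
  simp only [Function.comp_def, biEmb_C_powerCurrent, biEmb_map_C_powerCurrent]
  rw [biEmb_C, biEmb_X, HahnSeries.ofPowerSeries_X]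
  exact currentRel_atU_atV q ρ

end Transfer

/-! ### From the relations of `Aq` to homogeneous exchange relations -/

namespace CurrentRel

/-- The structure constants are rational expressions in q and ρ, so they may be read in a larger
field; it will be the field of two-variable scalar series, which contains U and V. -/
theorem extendScalars {K F R : Type*} [Field K] [Field F] [Ring R] [Algebra K R] [Algebra F R]
    {q ρ : K} {s t : R} {W G W' G' : Sgn → R} (r : CurrentRel q ρ s t W G W' G') (φ : K →+* F)
    (h : ∀ (k : K) (x : R), φ k • x = k • x) : CurrentRel (φ q) (φ ρ) s t W G W' G' := by
  replace h : ∀ (k : K) (x : R), k • x = φ k • x := fun k x => (h k x).symm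
  refine ⟨r.w_comm, fun e => ?_, fun e => ?_, fun e => ?_, fun e => ?_, r.g_w_comm, r.g_comm⟩
  · simpa only [h, map_div₀, map_sub, map_mul, map_add, map_inv₀, map_one, map_pow] using r.w_w e
  · simpa only [h, map_div₀, map_sub, map_mul, map_add, map_inv₀, map_one, map_pow] using r.ww_gg e
  · simpa only [qComm, h, map_div₀, map_sub, map_mul, map_add, map_inv₀, map_one, map_pow]
      using r.g_w e
  · simpa only [qComm, h, map_div₀, map_sub, map_mul, map_add, map_inv₀, map_one, map_pow]
      using r.w_g e

end CurrentRel

/-- The affine change of the currents `G_±` that makes the relations homogeneous. -/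
def shiftG {F R : Type*} [Field F] [Ring R] [Algebra F R] (q ρ : F) (G : Sgn → R) : Sgn → R
  | .plus => (q * (q - q⁻¹) / ρ) • (G .plus + (ρ / (q - q⁻¹)) • 1)
  | .minus => G .minus + (ρ / (q - q⁻¹)) • 1

section

variable {F R : Type*} [Field F] [Ring R] [Algebra F R] {q ρ U V : F} {W G W' G' : Sgn → R}

/-- The shift by ρ/(q-q⁻¹) completes the quadratic terms so as to absorb every linear term. Each
term quadratic in G has one G₊ and one G₋ (except in the commutativity of a G-current with itself),
so rescaling G₊ alone normalises its coefficient. -/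
theorem CurrentRel.exchangeRel (hq : q ≠ 0) (hq1 : q ^ 2 - 1 ≠ 0) (hq2 : q ^ 2 + 1 ≠ 0)
    (hρ : ρ ≠ 0) (hU : U ≠ 0) (hV : V ≠ 0)
    (r : CurrentRel q ρ (algebraMap F R U⁻¹) (algebraMap F R V⁻¹) W G W' G') :
    ExchangeRel (q ^ 2) 1 ((q ^ 2 + 1) * U) ((q ^ 2 + 1) * V) W (shiftG q ρ G) W' (shiftG q ρ G')
    := by
  have hp : q + q⁻¹ ≠ 0 := by
    intro h
    exact hq2 (by field_simp at h; simpa using h)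
  have hm : q - q⁻¹ ≠ 0 := by
    intro h
    exact hq1 (by field_simp at h; simpa using h)
  refine ⟨fun e => sub_eq_zero.1 (r.w_comm e), fun e => ?_, fun e => ?_, fun e => ?_, fun e => ?_,
    fun d e => ?_, fun e => ?_⟩
  · have h := r.w_w e
    simp only [← map_sub, ← map_mul, ← Algebra.smul_def] at h
    cases e <;> simp only [Sgn.opp, shiftG] at h ⊢ <;>
    -- The factor U V undoes the multiplication by U⁻¹V⁻¹, and q²+1 turns U - V into the difference
    -- of the rescaled points.
    · linear_combination (norm := skip) ((q ^ 2 + 1) * U * V) • h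
      simp only [smul_mul_assoc, mul_smul_comm, @mul_add R, @add_mul R, mul_one, one_mul]
      match_scalars <;> field_simp <;> ring
  · have hqq : q ^ 2 - q⁻¹ ^ 2 = (q - q⁻¹) * (q + q⁻¹) := by ring
    have h := r.ww_gg e
    rw [hqq] at h
    simp only [← map_sub, ← map_mul, ← map_one (algebraMap F R), ← Algebra.smul_def] at h
    cases e <;> simp only [Sgn.opp, shiftG] at h ⊢ <;>
    · linear_combination (norm := skip) ((q ^ 2 - 1) ^ 2 * (q ^ 2 + 1) ^ 2 * U * V) • h
      simp only [smul_mul_assoc, mul_smul_comm, @mul_add R, @add_mul R, mul_one, one_mul]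
      match_scalars <;> field_simp <;> ring
  · have h := r.g_w e
    simp only [qComm, ← map_mul, ← Algebra.smul_def] at h
    cases e <;> simp only [Sgn.opp, shiftG] at h ⊢
    · linear_combination (norm := skip) (q * (q ^ 2 + 1) * U * V) • h
      simp only [smul_mul_assoc, mul_smul_comm, @mul_add R, @add_mul R, mul_one, one_mul]
      match_scalars <;> field_simp <;> ring
    -- For the lower sign the G-current involved is the rescaled `plus` one, hence the extra factor.
    · linear_combination (norm := skip) (q * (q ^ 2 + 1) * U * V * (q * (q - q⁻¹) / ρ)) • h
      simp only [smul_mul_assoc, mul_smul_comm, @mul_add R, @add_mul R, mul_one, one_mul]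
      match_scalars <;> field_simp <;> ring
  · have h := r.w_g e
    simp only [qComm, ← map_mul, ← Algebra.smul_def] at h
    cases e <;> simp only [Sgn.opp, shiftG] at h ⊢
    · linear_combination (norm := skip) (q * (q ^ 2 + 1) * U * V) • h
      simp only [smul_mul_assoc, mul_smul_comm, @mul_add R, @add_mul R, mul_one, one_mul]
      match_scalars <;> field_simp <;> ring
    · linear_combination (norm := skip) (q * (q ^ 2 + 1) * U * V * (q * (q - q⁻¹) / ρ)) • h
      simp only [smul_mul_assoc, mul_smul_comm, @mul_add R, @add_mul R, mul_one, one_mul]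
      match_scalars <;> field_simp <;> ring
  · have h := r.g_w_comm d e
    cases d <;> simp only [shiftG] <;>
    · first
      | linear_combination (norm := skip) (q * (q - q⁻¹) / ρ) • h
        simp only [smul_mul_assoc, mul_smul_comm, @mul_add R, @add_mul R, mul_one, one_mul]
        match_scalars <;> ring1
      | linear_combination (norm := skip) h
        simp only [smul_mul_assoc, mul_smul_comm, @mul_add R, @add_mul R, mul_one, one_mul]
        match_scalars <;> ring1
  · have h := sub_eq_zero.1 (r.g_comm e)
    cases e <;> simp only [shiftG, smul_mul_assoc, mul_smul_comm, @mul_add R, @add_mul R, mul_one,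
      one_mul, h] <;> module

variable {a b U₁ U₂ V : F} {W₁ G₁ W₂ G₂ W₃ G₃ : Sgn → R}

/-- The generating function `Δ` built from the currents at two spectral points. -/
def deltaOf (q ρ U₁ U₂ : F) (W₁ G₁ W₂ G₂ : Sgn → R) : R :=
  -(((q - q⁻¹) * (q ^ 2 + q⁻¹ ^ 2)) • (W₁ .plus * W₂ .plus + W₁ .minus * W₂ .minus))
    - ((q - q⁻¹) / ρ) • (G₁ .plus * G₂ .minus + G₁ .minus * G₂ .plus)
    + (q - q⁻¹) • ((U₁ + U₂) • (W₁ .plus * W₂ .minus + W₁ .minus * W₂ .plus))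
    - G₁ .plus - G₂ .plus - G₁ .minus - G₂ .minus

/-- The linear terms of Δ are exactly the cross terms produced by the shift of the G-currents, and
the product of the two shifts gives the constant 2ρ/(q-q⁻¹). -/
theorem sklyaninDet_eq (hq : q ≠ 0) (hq1 : q ^ 2 - 1 ≠ 0) (hρ : ρ ≠ 0) (e : Sgn) :
    sklyaninDet (q ^ 2) 1 ((q ^ 2 + 1) * U₁) ((q ^ 2 + 1) * U₂) W₁ (shiftG q ρ G₁) W₂
        (shiftG q ρ G₂) e
      = (q ^ 3 * (q ^ 2 + 1)) • (deltaOf q ρ U₁ U₂ W₁ G₁ W₂ G₂ - (2 * ρ / (q - q⁻¹)) • 1) := by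
  have hm : q - q⁻¹ ≠ 0 := by
    intro h
    exact hq1 (by field_simp at h; simpa using h)
  cases e <;>
  · simp only [sklyaninDet, deltaOf, shiftG, Sgn.opp, smul_mul_assoc, mul_smul_comm, @mul_add R,
      @add_mul R, mul_one, one_mul]
    match_scalars <;> field_simp <;> ring

/-- Relations `r₁` and `r₂` compare each point with V. The relation `r` between the two points
themselves is taken in the order U₂, U₁, so that its degeneration constrains the products in the
order U₁, U₂ appearing in Δ. -/
theorem deltaOf_commute (hq : q ≠ 0) (hq4 : (q ^ 2) ^ 2 ≠ 1) (hρ : ρ ≠ 0) (hU₁ : U₁ ≠ 0)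
    (hU₂ : U₂ ≠ 0) (hV : V ≠ 0) (hab : a * b = 1) (hab2 : a ^ 2 ≠ b ^ 2)
    (h₁ : (q ^ 2 + 1) * U₁ = a ^ 2 + q ^ 2 * b ^ 2) (h₂ : (q ^ 2 + 1) * U₂ = q ^ 2 * a ^ 2 + b ^ 2)
    (n₁ : exchangeNorm (q ^ 2) 1 ((q ^ 2 + 1) * U₁) ((q ^ 2 + 1) * V) ≠ 0)
    (n₂ : exchangeNorm (q ^ 2) 1 ((q ^ 2 + 1) * U₂) ((q ^ 2 + 1) * V) ≠ 0)
    (r₁ : CurrentRel q ρ (algebraMap F R U₁⁻¹) (algebraMap F R V⁻¹) W₁ G₁ W₃ G₃)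
    (r₂ : CurrentRel q ρ (algebraMap F R U₂⁻¹) (algebraMap F R V⁻¹) W₂ G₂ W₃ G₃)
    (r : CurrentRel q ρ (algebraMap F R U₂⁻¹) (algebraMap F R U₁⁻¹) W₂ G₂ W₁ G₁) (e : Sgn) :
    Commute (deltaOf q ρ U₁ U₂ W₁ G₁ W₂ G₂) (W₃ e) ∧
      Commute (deltaOf q ρ U₁ U₂ W₁ G₁ W₂ G₂) (G₃ e) := by
  have hq1 : q ^ 2 - 1 ≠ 0 := fun h => hq4 (by linear_combination (q ^ 2 + 1) * h)
  have hq2 : q ^ 2 + 1 ≠ 0 := fun h => hq4 (by linear_combination (q ^ 2 - 1) * h)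
  have hm : q - q⁻¹ ≠ 0 := by
    intro h
    exact hq1 (by field_simp at h; simpa using h)
  have hb : b ≠ 0 := right_ne_zero_of_mul_eq_one hab
  have x₁ := r₁.exchangeRel hq hq1 hq2 hρ hU₁ hV
  have x₂ := r₂.exchangeRel hq hq1 hq2 hρ hU₂ hV
  have x := r.exchangeRel hq hq1 hq2 hρ hU₂ hU₁
  rw [h₁, h₂, ← hab] at x
  have f := x.fusionRel hq4 hb hab2
  have hc : q ^ 3 * (q ^ 2 + 1) ≠ 0 := mul_ne_zero (pow_ne_zero _ hq) hq2
  have key : ∀ X : R,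
      (exchangeNorm (q ^ 2) 1 ((q ^ 2 + 1) * U₁) ((q ^ 2 + 1) * V) *
          exchangeNorm (q ^ 2) 1 ((q ^ 2 + 1) * U₂) ((q ^ 2 + 1) * V)) •
        (sklyaninDet (q ^ 2) 1 ((q ^ 2 + 1) * U₁) ((q ^ 2 + 1) * U₂) W₁ (shiftG q ρ G₁) W₂
          (shiftG q ρ G₂) e * X) =
      (exchangeNorm (q ^ 2) 1 ((q ^ 2 + 1) * U₁) ((q ^ 2 + 1) * V) *
          exchangeNorm (q ^ 2) 1 ((q ^ 2 + 1) * U₂) ((q ^ 2 + 1) * V)) •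
        (X * sklyaninDet (q ^ 2) 1 ((q ^ 2 + 1) * U₁) ((q ^ 2 + 1) * U₂) W₁ (shiftG q ρ G₁) W₂
          (shiftG q ρ G₂) e) → Commute (deltaOf q ρ U₁ U₂ W₁ G₁ W₂ G₂) X := by
    intro X h
    have h := smul_right_injective R (mul_ne_zero n₁ n₂) h
    simp only [sklyaninDet_eq hq hq1 hρ, smul_mul_assoc, mul_smul_comm] at h
    have h := smul_right_injective R hc h
    rw [commute_iff_eq]
    simpa [sub_mul, mul_sub] using h
  refine ⟨key _ (norm_smul_sklyaninDet_mul_w x₁ x₂ hab.symm h₁ h₂ e (f e) (f e.opp)), ?_⟩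
  have h := key _ (norm_smul_sklyaninDet_mul_g x₁ x₂ hab.symm h₁ h₂ e (f e) (f e.opp))
  -- The shifted current is a nonzero multiple of the original one plus a scalar, so commuting with
  -- either is the same.
  have hs : ∃ c d : F, c ≠ 0 ∧ shiftG q ρ G₃ e = c • (G₃ e + d • 1) := by
    cases e
    · exact ⟨_, _, div_ne_zero (mul_ne_zero hq hm) hρ, rfl⟩
    · exact ⟨1, _, one_ne_zero, (one_smul F _).symm⟩
  obtain ⟨c, d, hc0, hs⟩ := hs
  rw [hs] at h
  have h : deltaOf q ρ U₁ U₂ W₁ G₁ W₂ G₂ * _ = _ := h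
  simp only [smul_mul_assoc, mul_smul_comm] at h
  have h := smul_right_injective R hc0 h
  rw [commute_iff_eq]
  simpa [add_mul, mul_add] using h

end

/-! ### Scalar action and expansion of the currents about u = ∞ -/

section

variable {K A : Type*} [Field K] [Ring A] [Algebra K A]

theorem commute_laurent {x y : LaurentSeries A} (h : ∀ m n, Commute (x.coeff m) (y.coeff n)) :
    Commute x y := by
  ext n
  rw [HahnSeries.coeff_mul, HahnSeries.coeff_mul]
  refine Finset.sum_bij' (fun p _ => p.swap) (fun p _ => p.swap) ?_ ?_ ?_ ?_ ?_
  · intro p hp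
    simpa [add_comm, and_comm, and_assoc, and_left_comm] using hp
  · intro p hp
    simpa [add_comm, and_comm, and_assoc, and_left_comm] using hp
  · simp
  · simp
  · intro p _
    exact h _ _

theorem commute_biMap_ofId (x : BiSeries K) (y : BiSeries A) :
    Commute (biMap (Algebra.ofId K A) x) y :=
  commute_laurent fun _ _ => commute_laurent fun _ _ => Algebra.commutes _ _

/-- Two-variable Laurent series over `A` as an algebra over scalar ones. -/
noncomputable abbrev biAlgebra (K A : Type*) [Field K] [Ring A] [Algebra K A] :
    Algebra (BiSeries K) (BiSeries A) :=
  RingHom.toAlgebra' (biMap (Algebra.ofId K A) : BiSeries K →+* BiSeries A)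
    fun x y => commute_biMap_ofId x y

/-- `U(tu)⁻¹` as a power series in `u⁻¹`. -/
noncomputable def invU (q t : K) : PowerSeries K :=
  PowerSeries.mk fun n => ((Uexp q t)⁻¹).coeff n

variable {q t : K}

theorem coeff_inv_Uexp (hq : q ≠ 0) (hq2 : q + q⁻¹ ≠ 0) (ht : t ≠ 0) {n : ℤ} (hn : n < 2) :
    ((Uexp q t)⁻¹).coeff n = 0 := by
  simpa [Upow] using Upow_coeff_eq_zero hq hq2 ht 0 n (by simpa using hn)

theorem ofPowerSeries_invU (hq : q ≠ 0) (hq2 : q + q⁻¹ ≠ 0) (ht : t ≠ 0) :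
    HahnSeries.ofPowerSeries ℤ K (invU q t) = (Uexp q t)⁻¹ := by
  ext n
  rw [coeff_ofPowerSeries]
  split_ifs with h
  · rw [invU, PowerSeries.coeff_mk, Int.toNat_of_nonneg h]
  · rw [coeff_inv_Uexp hq hq2 ht (by omega)]

theorem coeff_invU_pow (hq : q ≠ 0) (hq2 : q + q⁻¹ ≠ 0) (ht : t ≠ 0) (k n : ℕ) :
    PowerSeries.coeff n (invU q t ^ (k + 1)) = (Upow q t k).coeff n := by
  rw [Upow, ← ofPowerSeries_invU hq hq2 ht, ← map_pow, HahnSeries.ofPowerSeries_apply_coeff]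

theorem constantCoeff_invU (hq : q ≠ 0) (hq2 : q + q⁻¹ ≠ 0) (ht : t ≠ 0) :
    PowerSeries.constantCoeff (invU q t) = 0 := by
  rw [← PowerSeries.coeff_zero_eq_constantCoeff_apply, invU, PowerSeries.coeff_mk]
  exact coeff_inv_Uexp hq hq2 ht (by norm_num)

/-- `U(tu)⁻¹` as a power series in `u⁻¹` with coefficients in `A`. -/
noncomputable def invUA (A : Type*) [Ring A] [Algebra K A] (q t : K) : PowerSeries A :=
  PowerSeries.map (algebraMap K A) (invU q t)

theorem constantCoeff_invUA (hq : q ≠ 0) (hq2 : q + q⁻¹ ≠ 0) (ht : t ≠ 0) :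
    PowerSeries.constantCoeff (invUA A q t) = 0 := by
  rw [← PowerSeries.coeff_zero_eq_constantCoeff_apply, invUA, PowerSeries.coeff_map,
    PowerSeries.coeff_zero_eq_constantCoeff_apply, constantCoeff_invU hq hq2 ht, map_zero]

theorem commute_invUA (f : PowerSeries A) : Commute f (invUA A q t) := by
  ext n
  rw [PowerSeries.coeff_mul, PowerSeries.coeff_mul,
    ← Finset.Nat.sum_antidiagonal_swap]
  refine Finset.sum_congr rfl fun p _ => ?_
  simp [invUA, Algebra.commutes]

/-- Constant power series, as an algebra homomorphism. -/
noncomputable def constHom (K A : Type*) [Field K] [Ring A] [Algebra K A] :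
    A →ₐ[K] PowerSeries A :=
  { (PowerSeries.C : A →+* PowerSeries A) with commutes' := fun _ => (PowerSeries.algebraMap_apply ..).symm }

@[simp] theorem constHom_apply (a : A) : constHom K A a = PowerSeries.C a := rfl

/-- The expansion of a current about `u = ∞`. -/
noncomputable def expandHom (A : Type*) [Ring A] [Algebra K A]
    (hq : q ≠ 0) (hq2 : q + q⁻¹ ≠ 0) (ht : t ≠ 0) : PowerSeries A →ₐ[K] PowerSeries A :=
  substHom (constHom K A) (invUA A q t) (constantCoeff_invUA hq hq2 ht) commute_invUA

theorem expandHom_powerCurrent (hq : q ≠ 0) (hq2 : q + q⁻¹ ≠ 0) (ht : t ≠ 0) (a : ℕ → A) :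
    HahnSeries.ofPowerSeries ℤ A (expandHom A hq hq2 ht (powerCurrent a)) = expCurrent q t a := by
  rw [expCurrent]
  congr 1
  ext n
  -- Mode k sits in degree k+1 of `powerCurrent`; the vanishing degree-zero term is split off to
  -- match the range in `expCurrent`.
  rw [expandHom, coeff_substHom, PowerSeries.coeff_mk, Finset.sum_range_succ']
  simp only [powerCurrent, PowerSeries.coeff_succ_X_mul, PowerSeries.coeff_mk, constHom_apply,
    PowerSeries.coeff_zero_X_mul, map_zero, zero_mul, add_zero, PowerSeries.coeff_C_mul]
  refine Finset.sum_congr rfl fun k _ => ?_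
  rw [invUA, ← map_pow, PowerSeries.coeff_map, coeff_invU_pow hq hq2 ht, ← Algebra.commutes,
    Algebra.smul_def]

/-- The expansion of the first variable about `u = ∞`. -/
noncomputable def expandFst (A : Type*) [Ring A] [Algebra K A]
    (hq : q ≠ 0) (hq2 : q + q⁻¹ ≠ 0) (ht : t ≠ 0) :
    PowerSeries (PowerSeries A) →ₐ[K] BiSeries A :=
  (biEmb K A).comp (PowerSeries.mapAlgHom (expandHom A hq hq2 ht))

theorem expandFst_C (hq : q ≠ 0) (hq2 : q + q⁻¹ ≠ 0) (ht : t ≠ 0) (f : PowerSeries A) :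
    expandFst A hq hq2 ht (PowerSeries.C f)
      = HahnSeries.C (HahnSeries.ofPowerSeries ℤ A (expandHom A hq hq2 ht f)) := by
  rw [expandFst, AlgHom.comp_apply, PowerSeries.mapAlgHom_apply, PowerSeries.map_C, biEmb_C]
  rfl

theorem expandFst_X (hq : q ≠ 0) (hq2 : q + q⁻¹ ≠ 0) (ht : t ≠ 0) :
    expandFst A hq hq2 ht PowerSeries.X = HahnSeries.single 1 1 := by
  rw [expandFst, AlgHom.comp_apply, PowerSeries.mapAlgHom_apply, PowerSeries.map_X, biEmb_X]

theorem expandFst_map_C_powerCurrent (hq : q ≠ 0) (hq2 : q + q⁻¹ ≠ 0) (ht : t ≠ 0) (a : ℕ → A) :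
    expandFst A hq hq2 ht (PowerSeries.map PowerSeries.C (powerCurrent a)) = atV a := by
  rw [← biEmb_map_C_powerCurrent (K := K), expandFst, AlgHom.comp_apply,
    PowerSeries.mapAlgHom_apply]
  congr 1
  ext n : 1
  simp only [PowerSeries.coeff_map]
  exact substHom_C (constHom K A) (invUA A q t) (constantCoeff_invUA hq hq2 ht) commute_invUA _

/-- The expansion of both variables about `u = ∞`. -/
noncomputable def expandBoth (A : Type*) [Ring A] [Algebra K A] {t' : K}
    (hq : q ≠ 0) (hq2 : q + q⁻¹ ≠ 0) (ht : t ≠ 0) (ht' : t' ≠ 0) :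
    PowerSeries (PowerSeries A) →ₐ[K] BiSeries A :=
  ((biEmb K A).comp (constHom K (PowerSeries A))).comp
    (substHom (expandHom A hq hq2 ht) (invUA A q t') (constantCoeff_invUA hq hq2 ht')
      commute_invUA)

section

variable {t' : K}

theorem expandBoth_C (hq : q ≠ 0) (hq2 : q + q⁻¹ ≠ 0) (ht : t ≠ 0) (ht' : t' ≠ 0)
    (f : PowerSeries A) :
    expandBoth A hq hq2 ht ht' (PowerSeries.C f)
      = HahnSeries.C (HahnSeries.ofPowerSeries ℤ A (expandHom A hq hq2 ht f)) := by
  rw [expandBoth, AlgHom.comp_apply, AlgHom.comp_apply, substHom_C, constHom_apply, biEmb_C]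

theorem expandBoth_X (hq : q ≠ 0) (hq2 : q + q⁻¹ ≠ 0) (ht : t ≠ 0) (ht' : t' ≠ 0) :
    expandBoth A hq hq2 ht ht' PowerSeries.X
      = HahnSeries.C (HahnSeries.ofPowerSeries ℤ A (invUA A q t')) := by
  rw [expandBoth, AlgHom.comp_apply, AlgHom.comp_apply, substHom_X, constHom_apply, biEmb_C]

theorem expandBoth_map_C_powerCurrent (hq : q ≠ 0) (hq2 : q + q⁻¹ ≠ 0) (ht : t ≠ 0)
    (ht' : t' ≠ 0) (a : ℕ → A) :
    expandBoth A hq hq2 ht ht' (PowerSeries.map PowerSeries.C (powerCurrent a))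
      = HahnSeries.C (expCurrent q t' a) := by
  rw [expandBoth, AlgHom.comp_apply, AlgHom.comp_apply, constHom_apply, biEmb_C,
    ← expandHom_powerCurrent hq hq2 ht']
  congr 2
  ext n
  rw [coeff_substHom, expandHom, expandHom, coeff_substHom]
  refine Finset.sum_congr rfl fun k _ => ?_
  rw [PowerSeries.coeff_map, substHom_C]

end

theorem expandHom_X (hq : q ≠ 0) (hq2 : q + q⁻¹ ≠ 0) (ht : t ≠ 0) :
    expandHom A hq hq2 ht PowerSeries.X = invUA A q t := substHom_X _ _ _ _

/-- `U(tu)` as a scalar two-variable series. -/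
noncomputable def biU (q t : K) : BiSeries K := HahnSeries.C (Uexp q t)

theorem biMap_inv_biU (hq : q ≠ 0) (hq2 : q + q⁻¹ ≠ 0) (ht : t ≠ 0) :
    biMap (Algebra.ofId K A) (biU q t)⁻¹
      = HahnSeries.C (HahnSeries.ofPowerSeries ℤ A (invUA A q t)) := by
  have h : (biU q t)⁻¹ = HahnSeries.C (Uexp q t)⁻¹ := by
    rw [biU, map_inv₀]
  rw [h, biMap_C, ← ofPowerSeries_invU hq hq2 ht, laurentMap_ofPowerSeries]
  rfl

theorem inv_serV : (serV : BiSeries K)⁻¹ = HahnSeries.single 1 1 := by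
  apply inv_eq_of_mul_eq_one_left
  rw [serV, HahnSeries.single_mul_single]
  simp

theorem biMap_inv_serV :
    biMap (Algebra.ofId K A) (serV : BiSeries K)⁻¹ = HahnSeries.single 1 1 := by
  rw [inv_serV, biMap_single_one]

end

/-! ### Relations at the expanded points -/

section Central

variable {K : Type*} [Field K] {q ρ t t' : K}

/-- V stays formal: this is the relation with the third, arbitrary current. -/
theorem currentRel_expandFst (ρ : K) (hq : q ≠ 0) (hq2 : q + q⁻¹ ≠ 0) (ht : t ≠ 0) :
    CurrentRel q ρ (biMap (Algebra.ofId K (Aq q ρ)) (biU q t)⁻¹)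
      (biMap (Algebra.ofId K (Aq q ρ)) (serV : BiSeries K)⁻¹)
      (fun e => HahnSeries.C (Wexp q ρ t e)) (fun e => HahnSeries.C (Gexp q ρ t e))
      (fun e => atV (Wgen q ρ e)) (fun e => atV (Ggen q ρ e)) := by
  have h := (currentRel_powerSeries q ρ).map (expandFst (Aq q ρ) hq hq2 ht)
  simp only [Function.comp_def, expandFst_C, expandFst_map_C_powerCurrent, expandHom_powerCurrent,
    expandFst_X, expandHom_X] at h
  rw [biMap_inv_biU hq hq2 ht, biMap_inv_serV]
  exact h

/-- Both points are functions of u, so everything is constant in V; this feeds the fusion relations.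
-/
theorem currentRel_expandBoth (ρ : K) (hq : q ≠ 0) (hq2 : q + q⁻¹ ≠ 0) (ht : t ≠ 0)
    (ht' : t' ≠ 0) :
    CurrentRel q ρ (biMap (Algebra.ofId K (Aq q ρ)) (biU q t)⁻¹)
      (biMap (Algebra.ofId K (Aq q ρ)) (biU q t')⁻¹)
      (fun e => HahnSeries.C (Wexp q ρ t e)) (fun e => HahnSeries.C (Gexp q ρ t e))
      (fun e => HahnSeries.C (Wexp q ρ t' e)) (fun e => HahnSeries.C (Gexp q ρ t' e)) := by
  have h := (currentRel_powerSeries q ρ).map (expandBoth (Aq q ρ) hq hq2 ht ht')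
  simp only [Function.comp_def, expandBoth_C, expandBoth_map_C_powerCurrent,
    expandHom_powerCurrent, expandBoth_X, expandHom_X] at h
  rw [biMap_inv_biU hq hq2 ht, biMap_inv_biU hq hq2 ht']
  exact h

end Central

/-! ### Centrality of the coefficients of Δ(u) -/

section

variable {K : Type*} [Field K]

/-- As a polynomial in V the norm has leading coefficient Qc², which is nonzero. -/
theorem exchangeNorm_C_ne_zero {Q c : LaurentSeries K} (hQ : Q ≠ 0) (hc : c ≠ 0)
    (y : LaurentSeries K) :
    exchangeNorm (HahnSeries.C Q) 1 (HahnSeries.C y) (HahnSeries.C c * serV) ≠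
      (0 : BiSeries K) := by
  have h : exchangeNorm (HahnSeries.C Q) 1 (HahnSeries.C y) (HahnSeries.C c * serV) =
      (HahnSeries.single 0 (Q * y ^ 2 + (Q ^ 2 - 1) ^ 2)
        + HahnSeries.single (-1) (-((Q ^ 2 + 1) * y * c))
        + HahnSeries.single (-2) (Q * c ^ 2) : BiSeries K) := by
    have h0 : ∀ z : LaurentSeries K, (HahnSeries.single 0 z : BiSeries K) = HahnSeries.C z :=
      fun _ => rfl
    have h1 : ∀ z : LaurentSeries K,
        (HahnSeries.single (-1) z : BiSeries K) = HahnSeries.C z * serV := fun z => by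
      rw [serV, ← h0, HahnSeries.single_mul_single, zero_add, mul_one]
    have h2 : ∀ z : LaurentSeries K,
        (HahnSeries.single (-2) z : BiSeries K) = HahnSeries.C z * serV ^ 2 := fun z => by
      rw [serV, ← h0, HahnSeries.single_pow, HahnSeries.single_mul_single]
      simp
    rw [h0, h1, h2, exchangeNorm]
    simp only [map_add, map_mul, map_pow, map_sub, map_one, map_neg]
    ring
  intro h'
  have := congrArg (fun f => HahnSeries.coeff f (-2)) (h.symm.trans h')
  simp [hQ, hc] at this

variable {q ρ : K}

/-- Scalars as constant two-variable series. -/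
noncomputable def biConst (K : Type*) [Field K] : K →+* BiSeries K :=
  (HahnSeries.C : LaurentSeries K →+* BiSeries K).comp HahnSeries.C

@[simp] theorem biConst_apply (k : K) : biConst K k = HahnSeries.C (HahnSeries.C k) := rfl

theorem C_smul_laurent {A : Type*} [Ring A] [Algebra K A] (k : K) (x : LaurentSeries A) :
    (HahnSeries.C (k • x) : BiSeries A) = k • (HahnSeries.C x : BiSeries A) := by
  ext m n
  by_cases h : m = 0 <;> simp [HahnSeries.C_apply, h]

theorem biConst_smul {A : Type*} [Ring A] [Algebra K A] (k : K) (x : BiSeries A) :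
    letI := biAlgebra K A
    biConst K k • x = k • x := by
  change biMap (Algebra.ofId K A) (biConst K k) * x = _
  rw [biConst_apply, biMap_C, HahnSeries.C_apply, HahnSeries.C_apply, laurentMap_single]
  ext m n
  rw [HahnSeries.coeff_single_zero_mul, HahnSeries.coeff_single_zero_mul]
  exact (Algebra.smul_def k _).symm

theorem q_add_inv_ne_zero (hq : q ≠ 0) (hq4 : (q ^ 2) ^ 2 ≠ 1) : q + q⁻¹ ≠ 0 := by
  intro h
  field_simp at h
  exact hq4 (by linear_combination (q ^ 2 - 1) * h)

/-- For t = 1 and t = q this exhibits the rescaled points as a²+q²b² and q²a²+b² with a = qu, b =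
q⁻¹u⁻¹. -/
theorem mul_Uexp (hq : q ≠ 0) (hq2 : q ^ 2 + 1 ≠ 0) (t : K) :
    HahnSeries.C (q ^ 2 + 1) * Uexp q t
      = HahnSeries.single (-2) (q ^ 2 * t ^ 2) + HahnSeries.single 2 (t⁻¹ ^ 2) := by
  rw [Uexp, mul_add, HahnSeries.C_apply, HahnSeries.single_mul_single,
    HahnSeries.single_mul_single, zero_add, zero_add]
  have h : q + q⁻¹ = (q ^ 2 + 1) / q := by field_simp
  rw [h]
  congr 2 <;> field_simp

/-- Explains the factor u²q²+u⁻²q⁻² in Δ(u): it is the sum of the two spectral points. -/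
theorem Uexp_add_Uexp (hq : q ≠ 0) (hq2 : q ^ 2 + 1 ≠ 0) :
    Uexp q 1 + Uexp q q = HahnSeries.single (-2) (q ^ 2) + HahnSeries.single 2 (q⁻¹ ^ 2) := by
  have h : q + q⁻¹ = (q ^ 2 + 1) / q := by field_simp
  rw [Uexp, Uexp, add_add_add_comm, ← HahnSeries.single_add, ← HahnSeries.single_add, h]
  congr 2 <;> field_simp <;> ring

section

variable {A : Type*} [Ring A] [Algebra K A]

/-- The expression defining `Δ(u)` for arbitrary currents. -/
noncomputable def laurentDelta (q ρ : K) (W₁ G₁ W₂ G₂ : Sgn → LaurentSeries A) :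
    LaurentSeries A :=
  -(((q - q⁻¹) * (q ^ 2 + q⁻¹ ^ 2)) • (W₁ .plus * W₂ .plus + W₁ .minus * W₂ .minus))
    - ((q - q⁻¹) / ρ) • (G₁ .plus * G₂ .minus + G₁ .minus * G₂ .plus)
    + (q - q⁻¹) •
      ((HahnSeries.single (-2) (algebraMap K A (q ^ 2))
          + HahnSeries.single 2 (algebraMap K A (q⁻¹ ^ 2))) *
        (W₁ .plus * W₂ .minus + W₁ .minus * W₂ .plus))
    - G₁ .plus - G₂ .plus - G₁ .minus - G₂ .minus

theorem deltaOf_C (hq : q ≠ 0) (hq2 : q ^ 2 + 1 ≠ 0) (W₁ G₁ W₂ G₂ : Sgn → LaurentSeries A) :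
    letI := biAlgebra K A
    deltaOf (R := BiSeries A) (biConst K q) (biConst K ρ) (biU q 1)
      (biU q q) (fun e => HahnSeries.C (W₁ e)) (fun e => HahnSeries.C (G₁ e))
      (fun e => HahnSeries.C (W₂ e)) (fun e => HahnSeries.C (G₂ e))
    = HahnSeries.C (laurentDelta q ρ W₁ G₁ W₂ G₂) := by
  let _ := biAlgebra K A
  have hk : ∀ (k : K) (x : BiSeries A), biConst K k • x = k • x :=
    biConst_smul
  have hU : ∀ x : LaurentSeries A, (biU q 1 + biU q q) • (HahnSeries.C x : BiSeries A)
      = HahnSeries.C ((HahnSeries.single (-2) (algebraMap K A (q ^ 2))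
          + HahnSeries.single 2 (algebraMap K A (q⁻¹ ^ 2))) * x) := by
    intro x
    change biMap (Algebra.ofId K A) (biU q 1 + biU q q) * _ = _
    rw [biU, biU, ← map_add, Uexp_add_Uexp hq hq2, biMap_C, map_mul, map_add, laurentMap_single,
      laurentMap_single]
    rfl
  simp only [deltaOf, ← map_inv₀ (biConst K),
    ← map_sub (biConst K),
    ← map_pow (biConst K), ← map_add (biConst K),
    ← map_mul (biConst K), ← map_div₀ (biConst K), hk]
  simp only [← map_mul HahnSeries.C, ← map_add HahnSeries.C, hU, ← C_smul_laurent,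
    ← map_neg HahnSeries.C, ← map_sub HahnSeries.C]
  rfl

end

theorem C_DeltaSeries_commute (hq : q ≠ 0) (hq4 : (q ^ 2) ^ 2 ≠ 1) (hρ : ρ ≠ 0) (e : Sgn) :
    Commute (HahnSeries.C (DeltaSeries q ρ) : BiSeries (Aq q ρ)) (atV (Wgen q ρ e)) ∧
      Commute (HahnSeries.C (DeltaSeries q ρ) : BiSeries (Aq q ρ)) (atV (Ggen q ρ e)) := by
  have hq1 : q ^ 2 + 1 ≠ 0 := fun h => hq4 (by linear_combination (q ^ 2 - 1) * h)
  have hq2 := q_add_inv_ne_zero hq hq4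
  let _ := biAlgebra K (Aq q ρ)
  have ha : ∀ k : K, biConst K k = HahnSeries.C (HahnSeries.C k) := fun k => rfl
  have hinj : Function.Injective (biConst K) := (biConst K).injective
  have hC : ∀ x : LaurentSeries K, x ≠ 0 → (HahnSeries.C x : BiSeries K) ≠ 0 := fun x hx h =>
    hx (HahnSeries.C_injective (h.trans (map_zero _).symm))
  have hK : ∀ x : K, x ≠ 0 → (HahnSeries.C x : LaurentSeries K) ≠ 0 := fun x hx h =>
    hx (HahnSeries.C_injective (h.trans (map_zero _).symm))
  have hV : (serV : BiSeries K) ≠ 0 := by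
    rw [serV]
    exact HahnSeries.single_ne_zero one_ne_zero
  have hp : ∀ (n : ℤ) (x : K), (HahnSeries.C (HahnSeries.single n x) : BiSeries K) ^ 2
      = HahnSeries.C (HahnSeries.single (2 * n) (x ^ 2)) := fun n x => by
    rw [← map_pow, HahnSeries.single_pow]
    simp
  have hn : ∀ y : LaurentSeries K, exchangeNorm (biConst K q ^ 2) 1
      ((biConst K q ^ 2 + 1) * HahnSeries.C y)
      ((biConst K q ^ 2 + 1) * serV) ≠ 0 := by
    intro y
    have h := exchangeNorm_C_ne_zero (hK _ (pow_ne_zero 2 hq)) (hK _ hq1)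
      (HahnSeries.C (q ^ 2 + 1) * y)
    simpa only [biConst_apply, map_mul, map_pow, map_add, map_one] using h
  have hU : ∀ t : K, (biConst K q ^ 2 + 1) * biU q t
      = HahnSeries.C (HahnSeries.single (-2) (q ^ 2 * t ^ 2) + HahnSeries.single 2 (t⁻¹ ^ 2)) := by
    intro t
    rw [← mul_Uexp hq hq1, map_mul, biU, ha, map_add, map_add, map_one, map_one, map_pow, map_pow]
  -- Here a = qu and b = q⁻¹u⁻¹, so ab = 1, while a² and b² are distinguished by the coefficient of
  -- u².
  have key := deltaOf_commute (R := BiSeries (Aq q ρ))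
    (a := HahnSeries.C (HahnSeries.single (-1) q)) (b := HahnSeries.C (HahnSeries.single 1 q⁻¹))
    (q := biConst K q) (ρ := biConst K ρ)
    (U₁ := biU q 1) (U₂ := biU q q) (V := serV)
    (hC _ (hK _ hq)) ?_ (hC _ (hK _ hρ)) (hC _ (Uexp_order hq hq2 one_ne_zero).1)
    (hC _ (Uexp_order hq hq2 hq).1) hV ?_ ?_ ?_ ?_ (hn _) (hn _)
    ((currentRel_expandFst ρ hq hq2 one_ne_zero).extendScalars (biConst K) biConst_smul)
    ((currentRel_expandFst ρ hq hq2 hq).extendScalars (biConst K) biConst_smul)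
    ((currentRel_expandBoth ρ hq hq2 hq one_ne_zero).extendScalars (biConst K) biConst_smul) e
  · rw [deltaOf_C hq hq1] at key
    exact key
  · rw [← map_pow, ← map_pow]
    exact fun h => hq4 (hinj (h.trans (map_one _).symm))
  · rw [← map_mul, HahnSeries.single_mul_single, mul_inv_cancel₀ hq]
    exact map_one _
  · rw [hp, hp]
    intro h
    have h := congrArg (fun f => HahnSeries.coeff f (-2)) (HahnSeries.C_injective h)
    norm_num at h
    exact hq h
  · rw [hU, hp, hp, ← map_pow, ha, ← map_mul, ← map_add,
      HahnSeries.C_apply (Γ := ℤ) (q ^ 2), HahnSeries.single_mul_single]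
    norm_num [hq]
  · rw [hU, hp, hp, ← map_pow, ha, ← map_mul, ← map_add,
      HahnSeries.C_apply (Γ := ℤ) (q ^ 2), HahnSeries.single_mul_single]
    norm_num [hq]

theorem coeff_atV {A : Type*} [Ring A] (a : ℕ → A) (k : ℕ) :
    HahnSeries.coeff (atV a) (k + 1 : ℤ) = HahnSeries.C (a k) := by
  rw [atV, HahnSeries.coeff_single_mul_add, one_mul, HahnSeries.ofPowerSeries_apply_coeff,
    PowerSeries.coeff_mk]

/-- A series in u⁻¹ alone is constant in V, so commutation with a current in V separates into
commutation of each coefficient with each mode. -/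
theorem coeff_commute_of_commute_atV {A : Type*} [Ring A] {x : LaurentSeries A} {a : ℕ → A}
    (h : Commute (HahnSeries.C x : BiSeries A) (atV a)) (n : ℤ) (k : ℕ) :
    Commute (x.coeff n) (a k) := by
  have h := congrArg (fun f => HahnSeries.coeff (HahnSeries.coeff f (k + 1 : ℤ)) n) h.eq
  simp only [HahnSeries.C_apply] at h
  rw [HahnSeries.coeff_single_zero_mul, HahnSeries.coeff_mul_single_zero, coeff_atV,
    HahnSeries.C_apply, HahnSeries.coeff_single_zero_mul, HahnSeries.coeff_mul_single_zero] at h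
  exact h

/-- Commuting with the generators of `𝒜_q` implies being central. -/
theorem commute_of_commute_gen {z : Aq q ρ} (hW : ∀ e k, Commute z (Wgen q ρ e k))
    (hG : ∀ e k, Commute z (Ggen q ρ e k)) (X : Aq q ρ) : Commute z X := by
  obtain ⟨x, rfl⟩ := RingQuot.mkAlgHom_surjective K (Rel q ρ) X
  induction x using FreeAlgebra.induction with
  | grade0 r => rw [AlgHom.commutes]; exact (Algebra.commutes r z).symm
  | grade1 g =>
    cases g with
    | W e k => exact hW e k
    | G e k => exact hG e k
  | mul a b ha hb => rw [map_mul]; exact ha.mul_right hb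
  | add a b ha hb => rw [map_add]; exact ha.add_right hb

theorem coeff_DeltaSeries_commute (hq : q ≠ 0) (hq4 : (q ^ 2) ^ 2 ≠ 1) (hρ : ρ ≠ 0) (n : ℤ)
    (X : Aq q ρ) : Commute ((DeltaSeries q ρ).coeff n) X :=
  commute_of_commute_gen
    (fun e k => coeff_commute_of_commute_atV (C_DeltaSeries_commute hq hq4 hρ e).1 n k)
    (fun e k => coeff_commute_of_commute_atV (C_DeltaSeries_commute hq hq4 hρ e).2 n k) X

end

/-! ### Powers of U(tu)⁻¹ as series in u⁻⁴ -/

section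

variable {K : Type*} [Field K]

/-- Power series in `y = u⁻⁴` as Laurent series in `u⁻¹`. -/
noncomputable def quarticHom (K : Type*) [Field K] : PowerSeries K →+* LaurentSeries K :=
  (HahnSeries.embDomainRingHom ((4 : ℤ) • (Nat.castAddMonoidHom ℤ))
    (fun a b h => by simpa using h) (fun a b => by simp)).comp
    (HahnSeries.toPowerSeries (R := K)).symm.toRingHom

theorem coeff_quarticHom (f : PowerSeries K) (m : ℕ) :
    (quarticHom K f).coeff (4 * m) = PowerSeries.coeff m f := by
  exact HahnSeries.embDomain_coeff

theorem coeff_quarticHom_of_ne (f : PowerSeries K) {n : ℤ} (h : ∀ m : ℕ, n ≠ 4 * m) :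
    (quarticHom K f).coeff n = 0 := by
  apply HahnSeries.embDomain_of_notMem_range
  rintro ⟨m, hm⟩
  have h4 : ((4 : ℤ) • Nat.castAddMonoidHom ℤ) m = n := hm
  exact h m (by simpa using h4.symm)

theorem quarticHom_C (x : K) : quarticHom K (PowerSeries.C x) = HahnSeries.single 0 x := by
  ext n
  by_cases h : ∃ m : ℕ, n = 4 * m
  · obtain ⟨m, rfl⟩ := h
    rw [coeff_quarticHom, PowerSeries.coeff_C]
    split_ifs with hm
    · simp [hm]
    · rw [HahnSeries.coeff_single_of_ne (by omega)]
  · push Not at h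
    rw [coeff_quarticHom_of_ne _ h, HahnSeries.coeff_single_of_ne (by simpa using h 0)]

theorem quarticHom_X : quarticHom K PowerSeries.X = HahnSeries.single 4 1 := by
  ext n
  by_cases h : ∃ m : ℕ, n = 4 * m
  · obtain ⟨m, rfl⟩ := h
    rw [coeff_quarticHom, PowerSeries.coeff_X]
    split_ifs with hm
    · simp [hm]
    · rw [HahnSeries.coeff_single_of_ne (by omega)]
  · push Not at h
    rw [coeff_quarticHom_of_ne _ h, HahnSeries.coeff_single_of_ne (by simpa using h 1)]

variable {q t : K}

/-- The power series `f` with `U(tu)^{-i-1} = u^{-2i-2} f(u⁻⁴)`. -/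
noncomputable def wSeries (q t : K) (i : ℕ) : PowerSeries K :=
  PowerSeries.mk fun m => w q m i * t⁻¹ ^ (2 * i + 2 + 4 * m)

/-- The power series `f` with `U(tu) = u² f(u⁻⁴)`. -/
noncomputable def uSeries (q t : K) : PowerSeries K :=
  PowerSeries.C (q * t ^ 2 / (q + q⁻¹)) + PowerSeries.C (q⁻¹ * t⁻¹ ^ 2 / (q + q⁻¹)) * PowerSeries.X

theorem Uexp_eq : Uexp q t = HahnSeries.single (-2) 1 * quarticHom K (uSeries q t) := by
  rw [uSeries, map_add, map_mul, quarticHom_C, quarticHom_C, quarticHom_X, mul_add, Uexp,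
    HahnSeries.single_mul_single, HahnSeries.single_mul_single, HahnSeries.single_mul_single]
  norm_num

theorem w_eq (m i : ℕ) : w q m i =
    (-1) ^ m * ((m + i).choose i : K) * (q + q⁻¹) ^ (i + 1) * q⁻¹ ^ (i + 2 * m + 1) := by
  rw [w, inv_pow, ← zpow_natCast q (i + 2 * m + 1), ← zpow_neg]
  congr 2
  push_cast
  ring

theorem coeff_wSeries_mul_uSeries_zero (i : ℕ) : PowerSeries.coeff 0 (wSeries q t i * uSeries q t)
    = w q 0 i * t⁻¹ ^ (2 * i + 2) * (q * t ^ 2 / (q + q⁻¹)) := by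
  simp [wSeries, uSeries]

theorem coeff_wSeries_mul_uSeries_succ (i m : ℕ) :
    PowerSeries.coeff (m + 1) (wSeries q t i * uSeries q t)
    = w q (m + 1) i * t⁻¹ ^ (2 * i + 2 + 4 * (m + 1)) * (q * t ^ 2 / (q + q⁻¹))
      + w q m i * t⁻¹ ^ (2 * i + 2 + 4 * m) * (q⁻¹ * t⁻¹ ^ 2 / (q + q⁻¹)) := by
  rw [uSeries, mul_add, ← mul_assoc, map_add, PowerSeries.coeff_mul_C, PowerSeries.coeff_succ_mul_X,
    PowerSeries.coeff_mul_C, wSeries, PowerSeries.coeff_mk, PowerSeries.coeff_mk]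

theorem wSeries_zero_mul_uSeries (hq : q ≠ 0) (hq2 : q + q⁻¹ ≠ 0) (ht : t ≠ 0) :
    wSeries q t 0 * uSeries q t = 1 := by
  ext m
  cases m with
  | zero =>
    rw [coeff_wSeries_mul_uSeries_zero, w_eq]
    generalize q + q⁻¹ = p at hq2
    simp
    field_simp
  | succ m =>
    rw [coeff_wSeries_mul_uSeries_succ, w_eq, w_eq, PowerSeries.coeff_one]
    generalize q + q⁻¹ = p at hq2
    simp
    field_simp
    ring

/-- The coefficients are those of a negative binomial expansion in the exponent i+1; multiplying by
U lowers the exponent, which is Pascal's rule. -/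
theorem wSeries_succ_mul_uSeries (hq : q ≠ 0) (hq2 : q + q⁻¹ ≠ 0) (ht : t ≠ 0) (i : ℕ) :
    wSeries q t (i + 1) * uSeries q t = wSeries q t i := by
  ext m
  cases m with
  | zero =>
    rw [coeff_wSeries_mul_uSeries_zero, wSeries, PowerSeries.coeff_mk, w_eq, w_eq]
    generalize q + q⁻¹ = p at hq2
    simp
    field_simp
    ring
  | succ m =>
    rw [coeff_wSeries_mul_uSeries_succ, wSeries, PowerSeries.coeff_mk, w_eq, w_eq, w_eq]
    generalize q + q⁻¹ = p at hq2
    rw [show m + 1 + (i + 1) = (m + i + 1) + 1 by ring, Nat.choose_succ_succ (m + i + 1) i,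
      show m + (i + 1) = m + i + 1 by ring, show m + 1 + i = m + i + 1 by ring, Nat.cast_add]
    -- Both parameters occur with powers of their inverses, so passing to the inverses as variables
    -- makes these exponents nonnegative.
    obtain ⟨r, rfl⟩ : ∃ r, q = r⁻¹ := ⟨q⁻¹, (inv_inv q).symm⟩
    obtain ⟨s, rfl⟩ : ∃ s, t = s⁻¹ := ⟨t⁻¹, (inv_inv t).symm⟩
    replace hq : r ≠ 0 := by simpa using hq
    replace ht : s ≠ 0 := by simpa using ht
    simp only [inv_inv]
    field_simp
    ring

theorem Upow_eq (hq : q ≠ 0) (hq2 : q + q⁻¹ ≠ 0) (ht : t ≠ 0) (i : ℕ) :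
    Upow q t i = HahnSeries.single (2 * i + 2 : ℤ) 1 * quarticHom K (wSeries q t i) := by
  have h0 := (Uexp_order hq hq2 ht).1
  induction i with
  | zero =>
    rw [Upow, zero_add, pow_one]
    apply inv_eq_of_mul_eq_one_left
    rw [Uexp_eq, mul_mul_mul_comm, ← map_mul, wSeries_zero_mul_uSeries hq hq2 ht,
      HahnSeries.single_mul_single, map_one]
    simp
  | succ i ih =>
    have h : Upow q t (i + 1) * Uexp q t = Upow q t i := by
      rw [Upow, pow_succ, mul_assoc, inv_mul_cancel₀ h0, mul_one, Upow]
    apply mul_right_cancel₀ h0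
    rw [h, Uexp_eq, mul_mul_mul_comm, ← map_mul, wSeries_succ_mul_uSeries hq hq2 ht,
      HahnSeries.single_mul_single, ih]
    push_cast
    ring_nf

theorem Upow_mul_Upow {t' : K} (hq : q ≠ 0) (hq2 : q + q⁻¹ ≠ 0) (ht : t ≠ 0) (ht' : t' ≠ 0)
    (i j : ℕ) :
    Upow q t i * Upow q t' j = HahnSeries.single (2 * (i + j) + 4 : ℤ) 1 *
      quarticHom K (wSeries q t i * wSeries q t' j) := by
  rw [Upow_eq hq hq2 ht, Upow_eq hq hq2 ht', mul_mul_mul_comm, ← map_mul,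
    HahnSeries.single_mul_single, mul_one]
  ring_nf

theorem coeff_single_mul_quarticHom (f : PowerSeries K) (a n : ℤ) (m : ℕ) (h : n = a + 4 * m) :
    (HahnSeries.single a 1 * quarticHom K f).coeff n = PowerSeries.coeff m f := by
  rw [h, add_comm, HahnSeries.coeff_single_mul_add, coeff_quarticHom, one_mul]

theorem coeff_single_mul_quarticHom_of_ne (f : PowerSeries K) {a n : ℤ}
    (h : ∀ m : ℕ, n ≠ a + 4 * m) :
    (HahnSeries.single a 1 * quarticHom K f).coeff n = 0 := by
  rw [HahnSeries.coeff_single_mul, coeff_quarticHom_of_ne, mul_zero]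
  intro m hm
  exact h m (by omega)

end

/-! ### Coefficients of products of currents -/

section

variable {K A : Type*} [Field K] [Ring A] [Algebra K A] {q ρ t t' : K}

theorem sum_range_Upow_coeff (hq : q ≠ 0) (hq2 : q + q⁻¹ ≠ 0) (ht : t ≠ 0) (a : ℕ → A) {n N : ℕ}
    (hn : n ≤ N) :
    ∑ i ∈ Finset.range n, (Upow q t i).coeff n • a i
      = ∑ i ∈ Finset.range N, (Upow q t i).coeff n • a i := by
  refine Finset.sum_subset (Finset.range_subset_range.2 hn) fun i _ hi => ?_
  rw [Finset.mem_range, not_lt] at hi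
  rw [Upow_coeff_eq_zero hq hq2 ht i n (by omega), zero_smul]

theorem coeff_expCurrent (hq : q ≠ 0) (hq2 : q + q⁻¹ ≠ 0) (ht : t ≠ 0) (a : ℕ → A) {n : ℤ} {N : ℕ}
    (hn : n ≤ N) :
    (expCurrent q t a).coeff n = ∑ i ∈ Finset.range N, (Upow q t i).coeff n • a i := by
  rw [expCurrent, coeff_ofPowerSeries]
  split_ifs with h
  · lift n to ℕ using h
    rw [PowerSeries.coeff_mk, Int.toNat_natCast]
    exact sum_range_Upow_coeff hq hq2 ht a (by omega)
  · refine (Finset.sum_eq_zero fun i _ => ?_).symm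
    rw [Upow_coeff_eq_zero hq hq2 ht i n (by omega), zero_smul]

theorem coeff_expCurrent_mul (hq : q ≠ 0) (hq2 : q + q⁻¹ ≠ 0) (ht : t ≠ 0) (ht' : t' ≠ 0)
    (a b : ℕ → A) {n : ℤ} {N : ℕ} (hn : n ≤ N) :
    (expCurrent q t a * expCurrent q t' b).coeff n
      = ∑ i ∈ Finset.range N, ∑ j ∈ Finset.range N,
          (Upow q t i * Upow q t' j).coeff n • (a i * b j) := by
  have hU : ∀ i j, Upow q t i * Upow q t' j
      = HahnSeries.ofPowerSeries ℤ K (invU q t ^ (i + 1) * invU q t' ^ (j + 1)) := by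
    intro i j
    rw [Upow, Upow, ← ofPowerSeries_invU hq hq2 ht, ← ofPowerSeries_invU hq hq2 ht', map_mul,
      map_pow, map_pow]
  simp only [hU]
  by_cases h : 0 ≤ n
  · lift n to ℕ using h
    have ha : ∀ m ≤ n, ∑ k ∈ Finset.range m, (Upow q t k).coeff (m : ℤ) • a k
        = ∑ k ∈ Finset.range N, PowerSeries.coeff m (invU q t ^ (k + 1)) • a k := by
      intro m hm
      simp only [coeff_invU_pow hq hq2 ht]
      exact sum_range_Upow_coeff hq hq2 ht a (by omega)
    have hb : ∀ m ≤ n, ∑ k ∈ Finset.range m, (Upow q t' k).coeff (m : ℤ) • b k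
        = ∑ k ∈ Finset.range N, PowerSeries.coeff m (invU q t' ^ (k + 1)) • b k := by
      intro m hm
      simp only [coeff_invU_pow hq hq2 ht']
      exact sum_range_Upow_coeff hq hq2 ht' b (by omega)
    simp only [expCurrent, ← map_mul, HahnSeries.ofPowerSeries_apply_coeff, PowerSeries.coeff_mul,
      PowerSeries.coeff_mk, Finset.sum_smul]
    have hs : ∀ p ∈ Finset.HasAntidiagonal.antidiagonal n,
        (∑ k ∈ Finset.range p.1, (Upow q t k).coeff (p.1 : ℤ) • a k) *
          (∑ k ∈ Finset.range p.2, (Upow q t' k).coeff (p.2 : ℤ) • b k)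
        = ∑ i ∈ Finset.range N, ∑ j ∈ Finset.range N,
          (PowerSeries.coeff p.1 (invU q t ^ (i + 1)) *
            PowerSeries.coeff p.2 (invU q t' ^ (j + 1))) • (a i * b j) := by
      intro p hp
      rw [Finset.HasAntidiagonal.mem_antidiagonal] at hp
      rw [ha _ (by omega), hb _ (by omega), Finset.sum_mul_sum]
      simp only [smul_mul_smul_comm]
    rw [Finset.sum_congr rfl hs, Finset.sum_comm]
    exact Finset.sum_congr rfl fun i _ => Finset.sum_comm
  · rw [expCurrent, expCurrent, ← map_mul, coeff_ofPowerSeries, if_neg h]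
    simp only [coeff_ofPowerSeries, if_neg h, zero_smul, Finset.sum_const_zero]

theorem coeff_two_point_mul {B : Type*} [Ring B] (α β : B) (x : LaurentSeries B) (n : ℤ) :
    ((HahnSeries.single (-2) α + HahnSeries.single 2 β) * x).coeff n
      = α * x.coeff (n + 2) + β * x.coeff (n - 2) := by
  rw [add_mul, HahnSeries.coeff_add, HahnSeries.coeff_single_mul, HahnSeries.coeff_single_mul,
    sub_neg_eq_add]

/-- The coefficients of `Δ(u)` as bilinear expressions in the modes of the currents. -/
theorem coeff_laurentDelta (hq : q ≠ 0) (hq2 : q + q⁻¹ ≠ 0) (ρ : K) (W G : Sgn → ℕ → A) {n : ℤ}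
    {N : ℕ} (hn : n + 2 ≤ N) :
    (laurentDelta q ρ (fun e => expCurrent q 1 (W e)) (fun e => expCurrent q 1 (G e))
      (fun e => expCurrent q q (W e)) (fun e => expCurrent q q (G e))).coeff n
    = -∑ i ∈ Finset.range N, ∑ j ∈ Finset.range N, (Upow q 1 i * Upow q q j).coeff n •
        ((q - q⁻¹) • ((q ^ 2 + q⁻¹ ^ 2) • (W .plus i * W .plus j + W .minus i * W .minus j)
          + (1 / ρ) • (G .plus i * G .minus j + G .minus i * G .plus j)))
      + ∑ i ∈ Finset.range N, ∑ j ∈ Finset.range N,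
        ((HahnSeries.single (-2) (q ^ 2) + HahnSeries.single 2 (q⁻¹ ^ 2)) *
          (Upow q 1 i * Upow q q j)).coeff n •
        ((q - q⁻¹) • (W .plus i * W .minus j + W .minus i * W .plus j))
      - ∑ i ∈ Finset.range N, ((Upow q 1 i).coeff n + (Upow q q i).coeff n) •
          (G .plus i + G .minus i) := by
  have h1 : (1 : K) ≠ 0 := one_ne_zero
  simp only [laurentDelta, HahnSeries.coeff_sub, HahnSeries.coeff_add, HahnSeries.coeff_neg,
    HahnSeries.coeff_smul, coeff_two_point_mul]
  rw [coeff_expCurrent hq hq2 h1 _ (show n ≤ N by omega),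
    coeff_expCurrent hq hq2 h1 _ (show n ≤ N by omega),
    coeff_expCurrent hq hq2 hq _ (show n ≤ N by omega),
    coeff_expCurrent hq hq2 hq _ (show n ≤ N by omega)]
  -- The two-point factor reads the coefficients n+2 and n-2 of the product; n+2 dictates the bound
  -- on N.
  simp only [coeff_expCurrent_mul hq hq2 h1 hq _ _ (show n ≤ N by omega),
    coeff_expCurrent_mul hq hq2 h1 hq _ _ (show n + 2 ≤ N by omega),
    coeff_expCurrent_mul hq hq2 h1 hq _ _ (show n - 2 ≤ N by omega), ← Algebra.smul_def]
  simp only [Finset.smul_sum, ← Finset.sum_neg_distrib, ← Finset.sum_add_distrib,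
    ← Finset.sum_sub_distrib]
  refine Finset.sum_congr rfl fun i _ => ?_
  rw [sub_sub, sub_sub, sub_sub]
  refine congrArg₂ (· - ·) (Finset.sum_congr rfl fun j _ => ?_) ?_ <;> module

end

/-! ### The explicit formula -/

section

variable {K : Type*} [Field K] {q ρ : K}

theorem cc_ne_zero (hq : q ≠ 0) (hroot : ∀ n : ℕ, 0 < n → q ^ n ≠ 1) (k : ℕ) : cc q k ≠ 0 := by
  have h : ∀ n : ℕ, 0 < n → q ^ n + q⁻¹ ^ n ≠ 0 := by
    intro n hn h
    refine hroot (4 * n) (by omega) ?_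
    have h' : q ^ n * q⁻¹ ^ n = 1 := by rw [← mul_pow, mul_inv_cancel₀ hq, one_pow]
    rw [mul_comm, pow_mul]
    -- If qⁿ + q⁻ⁿ = 0 then q²ⁿ = -1, so q⁴ⁿ = 1.
    linear_combination (q ^ n * (q ^ n) ^ 2 - q ^ n) * h - ((q ^ n) ^ 2 - 1) * h'
  rw [cc, neg_ne_zero]
  refine div_ne_zero (mul_ne_zero (pow_ne_zero _ ?_) (h _ k.succ_pos)) (pow_ne_zero _ hq)
  simpa using h 1 one_pos

/-- The product starts at u^{-2(i+j)-4} and proceeds in steps of u⁻⁴; M is the number of steps to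
u^{-2k-2}, and the sum is the Cauchy product. -/
theorem coeff_Upow_mul_Upow (hq : q ≠ 0) (hq2 : q + q⁻¹ ≠ 0) {i j M k : ℕ}
    (h : i + j + 1 + 2 * M = k) :
    (Upow q 1 i * Upow q q j).coeff (2 * (k : ℤ) + 2)
      = ∑ m ∈ Finset.range (M + 1), w q (M - m) i * w q m j * q ^ (-2 * (j : ℤ) - 4 * m - 2) := by
  rw [Upow_mul_Upow hq hq2 one_ne_zero hq,
    coeff_single_mul_quarticHom _ _ _ M (by subst h; push_cast; ring), PowerSeries.coeff_mul,
    ← Finset.Nat.sum_antidiagonal_swap,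
    Finset.Nat.sum_antidiagonal_eq_sum_range_succ_mk]
  refine Finset.sum_congr rfl fun m _ => ?_
  simp only [Prod.swap_prod_mk, wSeries, PowerSeries.coeff_mk, inv_one, one_pow, mul_one]
  rw [← mul_assoc, inv_pow, ← zpow_natCast q, ← zpow_neg]
  congr 2
  push_cast
  ring

theorem coeff_Upow_mul_Upow_of_ne (hq : q ≠ 0) (hq2 : q + q⁻¹ ≠ 0) {i j : ℕ} {n : ℤ}
    (h : ∀ M : ℕ, n ≠ 2 * (i + j) + 4 + 4 * M) : (Upow q 1 i * Upow q q j).coeff n = 0 := by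
  rw [Upow_mul_Upow hq hq2 one_ne_zero hq, coeff_single_mul_quarticHom_of_ne _ h]

/-- The factor is u²(q²+q⁻²u⁻⁴). Its second term shifts the series in u⁻⁴ by one place, which is
where w_{m-1}^j comes from. -/
theorem two_point_mul_Upow_mul_Upow (hq : q ≠ 0) (hq2 : q + q⁻¹ ≠ 0) (i j : ℕ) :
    (HahnSeries.single (-2) (q ^ 2) + HahnSeries.single 2 (q⁻¹ ^ 2)) * (Upow q 1 i * Upow q q j)
      = HahnSeries.single (2 * (i + j) + 2 : ℤ) 1 * quarticHom K (wSeries q 1 i *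
        (PowerSeries.mk fun m => (w q m j + wPred q m j) * q ^ (-2 * (j : ℤ) - 4 * m))) := by
  have h1 : (HahnSeries.single (-2) (q ^ 2) + HahnSeries.single 2 (q⁻¹ ^ 2) : LaurentSeries K)
      = HahnSeries.single (-2) 1 *
        quarticHom K (PowerSeries.C (q ^ 2) + PowerSeries.C (q⁻¹ ^ 2) * PowerSeries.X) := by
    rw [map_add, map_mul, quarticHom_C, quarticHom_C, quarticHom_X, mul_add,
      HahnSeries.single_mul_single, HahnSeries.single_mul_single, HahnSeries.single_mul_single]
    norm_num
  have h2 : (PowerSeries.C (q ^ 2) + PowerSeries.C (q⁻¹ ^ 2) * PowerSeries.X) * wSeries q q j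
      = PowerSeries.mk fun m => (w q m j + wPred q m j) * q ^ (-2 * (j : ℤ) - 4 * m) := by
    ext m
    rw [add_mul, map_add, mul_assoc, PowerSeries.coeff_C_mul, PowerSeries.coeff_C_mul,
      PowerSeries.coeff_mk, add_mul]
    have e1 : ∀ m : ℕ, q ^ 2 * (w q m j * q⁻¹ ^ (2 * j + 2 + 4 * m))
        = w q m j * q ^ (-2 * (j : ℤ) - 4 * m) := by
      intro m
      rw [mul_left_comm, inv_pow, ← zpow_natCast q, ← zpow_natCast q, ← zpow_neg, ← zpow_add₀ hq]
      congr 2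
      push_cast
      ring
    have e2 : ∀ m : ℕ, q⁻¹ ^ 2 * (w q m j * q⁻¹ ^ (2 * j + 2 + 4 * m))
        = w q m j * q ^ (-2 * (j : ℤ) - 4 * (m + 1)) := by
      intro m
      rw [mul_left_comm, inv_pow, inv_pow, ← zpow_natCast q, ← zpow_natCast q, ← zpow_neg,
        ← zpow_neg, ← zpow_add₀ hq]
      congr 2
      push_cast
      ring
    rw [wSeries, PowerSeries.coeff_mk, e1]
    congr 1
    cases m with
    | zero => simp [wPred]
    | succ m =>
      rw [PowerSeries.coeff_succ_X_mul, PowerSeries.coeff_mk, e2, wPred, if_neg m.succ_ne_zero]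
      push_cast
      rfl
  rw [h1, Upow_mul_Upow hq hq2 one_ne_zero hq, mul_mul_mul_comm, ← map_mul,
    HahnSeries.single_mul_single, mul_one, mul_left_comm, h2]
  congr 3
  ring

theorem coeff_two_point_mul_Upow_mul_Upow (hq : q ≠ 0) (hq2 : q + q⁻¹ ≠ 0) {i j M k : ℕ}
    (h : i + j + 2 * M = k) :
    ((HahnSeries.single (-2) (q ^ 2) + HahnSeries.single 2 (q⁻¹ ^ 2)) *
      (Upow q 1 i * Upow q q j)).coeff (2 * (k : ℤ) + 2)
      = ∑ m ∈ Finset.range (M + 1),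
        w q (M - m) i * (w q m j + wPred q m j) * q ^ (-2 * (j : ℤ) - 4 * m) := by
  rw [two_point_mul_Upow_mul_Upow hq hq2,
    coeff_single_mul_quarticHom _ _ _ M (by subst h; push_cast; ring), PowerSeries.coeff_mul,
    ← Finset.Nat.sum_antidiagonal_swap,
    Finset.Nat.sum_antidiagonal_eq_sum_range_succ_mk]
  refine Finset.sum_congr rfl fun m _ => ?_
  simp only [Prod.swap_prod_mk, wSeries, PowerSeries.coeff_mk, inv_one, one_pow, mul_one, mul_assoc]

theorem coeff_two_point_mul_Upow_mul_Upow_of_ne (hq : q ≠ 0) (hq2 : q + q⁻¹ ≠ 0) {i j : ℕ} {n : ℤ}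
    (h : ∀ M : ℕ, n ≠ 2 * (i + j) + 2 + 4 * M) :
    ((HahnSeries.single (-2) (q ^ 2) + HahnSeries.single 2 (q⁻¹ ^ 2)) *
      (Upow q 1 i * Upow q q j)).coeff n = 0 := by
  rw [two_point_mul_Upow_mul_Upow hq hq2, coeff_single_mul_quarticHom_of_ne _ h]

theorem coeff_Upow_add_coeff_Upow (hq : q ≠ 0) (hq2 : q + q⁻¹ ≠ 0) {i M k : ℕ}
    (h : i + 2 * M = k) :
    (Upow q 1 i).coeff (2 * (k : ℤ) + 2) + (Upow q q i).coeff (2 * (k : ℤ) + 2)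
      = w q M i * (1 + q ^ (-2 * (k : ℤ) - 2)) := by
  rw [Upow_eq hq hq2 one_ne_zero, Upow_eq hq hq2 hq,
    coeff_single_mul_quarticHom _ _ _ M (by subst h; push_cast; ring),
    coeff_single_mul_quarticHom _ _ _ M (by subst h; push_cast; ring), wSeries, wSeries,
    PowerSeries.coeff_mk, PowerSeries.coeff_mk, mul_add, inv_one, one_pow, inv_pow,
    ← zpow_natCast q, ← zpow_neg]
  congr 3
  subst h
  push_cast
  ring

theorem coeff_Upow_of_ne (hq : q ≠ 0) (hq2 : q + q⁻¹ ≠ 0) {t : K} (ht : t ≠ 0) {i : ℕ} {n : ℤ}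
    (h : ∀ M : ℕ, n ≠ 2 * i + 2 + 4 * M) : (Upow q t i).coeff n = 0 := by
  rw [Upow_eq hq hq2 ht, coeff_single_mul_quarticHom_of_ne _ h]

/-- The left side is the coefficient of 𝔾_{k+1} in the coefficient of u^{-2k-2}, so c_{k+1} is what
normalises 𝔾_{k+1} to coefficient 1 in Δ_{k+1}. -/
theorem neg_w_zero_mul_eq_cc (hq : q ≠ 0) (k : ℕ) :
    -(w q 0 k * (1 + q ^ (-2 * (k : ℤ) - 2))) = cc q k := by
  have h : q ^ (-2 * (k : ℤ) - 2) = q⁻¹ ^ (2 * k + 2) := by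
    rw [inv_pow, ← zpow_natCast q, ← zpow_neg]
    congr 1
    push_cast
    ring
  rw [w_eq, h, cc]
  generalize q + q⁻¹ = p
  simp only [pow_zero, zero_add, Nat.choose_self, Nat.cast_one, one_mul, inv_pow, mul_zero, add_zero]
  field_simp
  ring

/-- Expanding Δ(u) gives 𝒢_{i+1}𝒢̃_{j+1}, whereas 𝔽_{ij} is written with i and j interchanged; the
coefficient of U^{-i-1}V^{-j-1} in the cross relation identifies the two symmetrised sums. -/
theorem Ggen_cross (q ρ : K) (i j : ℕ) :
    Ggen q ρ .plus j * Ggen q ρ .minus i + Ggen q ρ .minus j * Ggen q ρ .plus i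
      = Ggen q ρ .plus i * Ggen q ρ .minus j + Ggen q ρ .minus i * Ggen q ρ .plus j := by
  have hc : ∀ x : ℕ → Aq q ρ,
      (HahnSeries.single 1 1 * HahnSeries.ofPowerSeries ℤ (Aq q ρ) (PowerSeries.mk x)).coeff
        (i + 1 : ℤ) = x i := by
    intro x
    rw [HahnSeries.coeff_single_mul_add, HahnSeries.ofPowerSeries_apply_coeff, PowerSeries.coeff_mk,
      one_mul]
  have hUV : ∀ a b : ℕ → Aq q ρ, ((atU a * atV b).coeff (j + 1 : ℤ)).coeff (i + 1 : ℤ)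
      = a i * b j := by
    intro a b
    rw [atU, HahnSeries.C_apply, HahnSeries.coeff_single_zero_mul, coeff_atV, HahnSeries.C_apply,
      HahnSeries.coeff_mul_single_zero, hc]
  have hVU : ∀ a b : ℕ → Aq q ρ, ((atV a * atU b).coeff (j + 1 : ℤ)).coeff (i + 1 : ℤ)
      = a j * b i := by
    intro a b
    rw [atU, HahnSeries.C_apply, HahnSeries.coeff_mul_single_zero, coeff_atV, HahnSeries.C_apply,
      HahnSeries.coeff_single_zero_mul, hc]
  have h := biMap_eq_of_seriesRel (SeriesRel.g_cross (q := q) (ρ := ρ))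
  simp only [Ring.lie_def, map_add, map_sub, map_mul, map_zero, biMap_Gu, biMap_Gv] at h
  have h := congrArg (fun f => (HahnSeries.coeff f (j + 1 : ℤ)).coeff (i + 1 : ℤ)) h
  simp only [HahnSeries.coeff_add, HahnSeries.coeff_sub, hUV, hVU, HahnSeries.coeff_zero] at h
  rw [← sub_eq_zero, ← neg_eq_zero, ← h]
  abel

theorem sum_range_eq_sum_of_injOn {M : Type*} [AddCommMonoid M] {S N : ℕ} (φ : ℕ → ℕ)
    (hφ : Set.InjOn φ (Finset.range S)) (hN : ∀ l < S, φ l < N) (h : ℕ → M)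
    (h0 : ∀ i, (∀ l < S, i ≠ φ l) → h i = 0) :
    ∑ i ∈ Finset.range N, h i = ∑ l ∈ Finset.range S, h (φ l) := by
  symm
  refine Finset.sum_of_injOn φ hφ (fun l hl => ?_) (fun i _ hi => ?_) (fun _ _ => rfl)
  · simpa using hN l (by simpa using hl)
  · exact h0 i fun l hl e => hi ⟨l, by simpa using hl, e.symm⟩

/-- The summand is supported where i+j is in the image of φ, and injectivity of φ keeps the
antidiagonals disjoint. -/
theorem sum_range_range_eq_sum_antidiagonal {M : Type*} [AddCommMonoid M] {S N : ℕ} (φ : ℕ → ℕ)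
    (hφ : Set.InjOn φ (Finset.range S)) (hN : ∀ l < S, φ l < N) (h : ℕ → ℕ → M)
    (h0 : ∀ i j, (∀ l < S, i + j ≠ φ l) → h i j = 0) :
    ∑ i ∈ Finset.range N, ∑ j ∈ Finset.range N, h i j
      = ∑ l ∈ Finset.range S, ∑ p ∈ Finset.HasAntidiagonal.antidiagonal (φ l), h p.1 p.2 := by
  rw [← Finset.sum_product', Finset.sum_sigma']
  symm
  refine Finset.sum_of_injOn (fun x => x.2) ?_ ?_ ?_ (fun _ _ => rfl)
  · rintro ⟨l, p⟩ hl ⟨l', p'⟩ hl' (rfl : p = p')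
    simp only [Finset.coe_sigma, Set.mem_sigma_iff, Finset.mem_coe,
      Finset.HasAntidiagonal.mem_antidiagonal] at hl hl'
    obtain rfl := hφ hl.1 hl'.1 (hl.2.symm.trans hl'.2)
    rfl
  · rintro ⟨l, p⟩ hl
    simp only [Finset.coe_sigma, Set.mem_sigma_iff, Finset.mem_coe, Finset.mem_range,
      Finset.HasAntidiagonal.mem_antidiagonal] at hl
    have := hN l hl.1
    simp only [Finset.coe_product, Set.mem_prod, Finset.mem_coe, Finset.mem_range]
    omega
  · rintro ⟨i, j⟩ _ hi
    refine h0 i j fun l hl e => hi ⟨⟨l, (i, j)⟩, ?_, rfl⟩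
    simpa [e] using hl

theorem coeff_DeltaSeries (hq : q ≠ 0) (hq2 : q + q⁻¹ ≠ 0) (ρ : K) {n : ℤ} {N : ℕ}
    (hn : n + 2 ≤ N) :
    (DeltaSeries q ρ).coeff n
    = -∑ i ∈ Finset.range N, ∑ j ∈ Finset.range N,
          (Upow q 1 i * Upow q q j).coeff n • bbF q ρ i j
      + ∑ i ∈ Finset.range N, ∑ j ∈ Finset.range N,
        ((HahnSeries.single (-2) (q ^ 2) + HahnSeries.single 2 (q⁻¹ ^ 2)) *
          (Upow q 1 i * Upow q q j)).coeff n • bbW q ρ i j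
      - ∑ i ∈ Finset.range N, ((Upow q 1 i).coeff n + (Upow q q i).coeff n) • bbG q ρ i := by
  have h := coeff_laurentDelta hq hq2 ρ (Wgen q ρ) (Ggen q ρ) hn
  have hF : ∀ i j, bbF q ρ i j = (q - q⁻¹) • ((q ^ 2 + q⁻¹ ^ 2) •
        (Wgen q ρ .plus i * Wgen q ρ .plus j + Wgen q ρ .minus i * Wgen q ρ .minus j)
      + (1 / ρ) •
        (Ggen q ρ .plus i * Ggen q ρ .minus j + Ggen q ρ .minus i * Ggen q ρ .plus j)) :=
    fun i j => by rw [bbF, Ggen_cross]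
  simp only [hF]
  exact h

theorem coeff_DeltaSeries_of_ne (hq : q ≠ 0) (hq2 : q + q⁻¹ ≠ 0) (ρ : K) {n : ℤ}
    (hn : ¬ ∃ k : ℕ, n = 2 * (k : ℤ) + 2) : (DeltaSeries q ρ).coeff n = 0 := by
  push Not at hn
  rw [coeff_DeltaSeries hq hq2 ρ (n := n) (N := (n + 2).toNat) (by omega)]
  have h1 : ∀ i j, (Upow q 1 i * Upow q q j).coeff n = 0 := fun i j =>
    coeff_Upow_mul_Upow_of_ne hq hq2 fun M h => hn (i + j + 1 + 2 * M) (by rw [h]; push_cast; ring)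
  have h2 : ∀ i j, ((HahnSeries.single (-2) (q ^ 2) + HahnSeries.single 2 (q⁻¹ ^ 2)) *
      (Upow q 1 i * Upow q q j)).coeff n = 0 := fun i j =>
    coeff_two_point_mul_Upow_mul_Upow_of_ne hq hq2 fun M h =>
      hn (i + j + 2 * M) (by rw [h]; push_cast; ring)
  have h3 : ∀ t : K, t ≠ 0 → ∀ i, (Upow q t i).coeff n = 0 := fun t ht i =>
    coeff_Upow_of_ne hq hq2 ht fun M h => hn (i + 2 * M) (by rw [h]; push_cast; ring)
  simp only [h1, h2, h3 _ hq, h3 _ one_ne_zero, add_zero, zero_smul, Finset.sum_const_zero, neg_zero,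
    sub_zero]

theorem coeff_DeltaSeries_eq (hq : q ≠ 0) (hroot : ∀ n : ℕ, 0 < n → q ^ n ≠ 1) (ρ : K) (k : ℕ) :
    (DeltaSeries q ρ).coeff (2 * (k : ℤ) + 2) = cc q k • DeltaCoef q ρ k := by
  have hc := cc_ne_zero hq hroot k
  have hq2 : q + q⁻¹ ≠ 0 := q_add_inv_ne_zero hq (by rw [← pow_mul]; exact hroot _ (by norm_num))
  -- This identity replaces the case split on the parity of k: contributing indices are 2l+1-k̄ ≤ k
  -- for 𝕎 and 𝔾, and 2l+k̄ ≤ k-1 for 𝔽.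
  have hb : bar k ≤ 1 ∧ k + bar k = 2 * (k / 2) + 1 := by
    rw [bar]
    split_ifs with h
    · rw [Nat.even_iff] at h; omega
    · rw [Nat.even_iff] at h; omega
  have hF : ∑ i ∈ Finset.range (2 * k + 4), ∑ j ∈ Finset.range (2 * k + 4),
      (Upow q 1 i * Upow q q j).coeff (2 * (k : ℤ) + 2) • bbF q ρ i j
      = -(cc q k • ∑ l ∈ Finset.range (k / 2 + 1 - bar k),
        ∑ p ∈ Finset.HasAntidiagonal.antidiagonal (2 * l + bar k),
        eCoef q k p.1 p.2 • bbF q ρ p.1 p.2) := by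
    rw [sum_range_range_eq_sum_antidiagonal (S := k / 2 + 1 - bar k) (fun l => 2 * l + bar k)
      (fun a _ b _ h => by simpa using h) (fun l hl => by omega)]
    · simp only [Finset.smul_sum, ← Finset.sum_neg_distrib]
      refine Finset.sum_congr rfl fun l hl => Finset.sum_congr rfl fun p hp => ?_
      rw [Finset.mem_range] at hl
      rw [Finset.HasAntidiagonal.mem_antidiagonal] at hp
      rw [coeff_Upow_mul_Upow hq hq2 (M := k / 2 - (p.1 + p.2 + bar k) / 2) (by omega), eCoef,
        smul_smul, ← neg_smul, neg_mul (cc q k)⁻¹, mul_neg, neg_neg, mul_inv_cancel_left₀ hc]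
    · intro i j hij
      rw [coeff_Upow_mul_Upow_of_ne hq hq2, zero_smul]
      intro M h
      -- A contribution with M steps of u⁻⁴ has i+j = k-1-2M, hence this value of l.
      exact hij (k / 2 - bar k - M) (by omega) (by omega)
  have hW : ∑ i ∈ Finset.range (2 * k + 4), ∑ j ∈ Finset.range (2 * k + 4),
      ((HahnSeries.single (-2) (q ^ 2) + HahnSeries.single 2 (q⁻¹ ^ 2)) *
          (Upow q 1 i * Upow q q j)).coeff (2 * (k : ℤ) + 2) • bbW q ρ i j
      = cc q k • ∑ l ∈ Finset.range (k / 2 + 1),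
        ∑ p ∈ Finset.HasAntidiagonal.antidiagonal (2 * l + 1 - bar k),
        fCoef q k p.1 p.2 • bbW q ρ p.1 p.2 := by
    rw [sum_range_range_eq_sum_antidiagonal (S := k / 2 + 1) (fun l => 2 * l + 1 - bar k)
      (fun a _ b _ h => by simp only at h; omega) (fun l hl => by omega)]
    · simp only [Finset.smul_sum]
      refine Finset.sum_congr rfl fun l hl => Finset.sum_congr rfl fun p hp => ?_
      rw [Finset.mem_range] at hl
      rw [Finset.HasAntidiagonal.mem_antidiagonal] at hp
      rw [coeff_two_point_mul_Upow_mul_Upow hq hq2 (M := k / 2 - (p.1 + p.2 + bar k - 1) / 2)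
        (by omega), fCoef, smul_smul, mul_inv_cancel_left₀ hc]
    · intro i j hij
      rw [coeff_two_point_mul_Upow_mul_Upow_of_ne hq hq2, zero_smul]
      intro M h
      exact hij (k / 2 - M) (by omega) (by omega)
  have hG : ∑ i ∈ Finset.range (2 * k + 4), ((Upow q 1 i).coeff (2 * (k : ℤ) + 2)
        + (Upow q q i).coeff (2 * (k : ℤ) + 2)) • bbG q ρ i
      = -(cc q k • (bbG q ρ k + ∑ l ∈ Finset.range (k / 2),
        dCoef q k l • bbG q ρ (2 * l + 1 - bar k))) := by
    -- The last index l = [k/2] is i = k, split off as the leading term 𝔾_{k+1}; the others give the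
    -- d-terms.
    rw [sum_range_eq_sum_of_injOn (S := k / 2 + 1) (fun l => 2 * l + 1 - bar k)
      (fun a _ b _ h => by simp only at h; omega) (fun l hl => by omega), Finset.sum_range_succ,
      show 2 * (k / 2) + 1 - bar k = k by omega, add_comm, smul_add, neg_add]
    · congr 1
      · rw [coeff_Upow_add_coeff_Upow hq hq2 (M := 0) (by omega), ← neg_w_zero_mul_eq_cc hq,
          neg_smul, neg_neg]
      · simp only [Finset.smul_sum, ← Finset.sum_neg_distrib]
        refine Finset.sum_congr rfl fun l hl => ?_
        rw [Finset.mem_range] at hl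
        rw [coeff_Upow_add_coeff_Upow hq hq2 (M := k / 2 - l) (by omega), dCoef, smul_smul,
          ← neg_smul, mul_assoc, neg_mul (cc q k)⁻¹, mul_neg, neg_neg, mul_inv_cancel_left₀ hc]
    · intro i hi
      rw [coeff_Upow_of_ne hq hq2 one_ne_zero, coeff_Upow_of_ne hq hq2 hq, add_zero, zero_smul]
      all_goals
        intro M h
        exact hi (k / 2 - M) (by omega) (by omega)
  rw [coeff_DeltaSeries hq hq2 ρ (N := 2 * k + 4) (by push_cast; omega), hF, hW, hG, DeltaCoef]
  simp only [smul_add]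
  abel

end

end QOnsager

theorem lemma2p1 {K : Type*} [Field K] (q ρ : K) (hq : q ≠ 0)
    (hroot : ∀ n : ℕ, 0 < n → q ^ n ≠ 1) (hρ : ρ ≠ 0) :
    (∀ k : ℕ, QOnsager.cc q k ≠ 0) ∧
    (∀ k : ℕ, HahnSeries.coeff (QOnsager.DeltaSeries q ρ) (2 * (k : ℤ) + 2)
      = QOnsager.cc q k • QOnsager.DeltaCoef q ρ k) ∧
    (∀ n : ℤ, (¬ ∃ k : ℕ, n = 2 * (k : ℤ) + 2) →
      HahnSeries.coeff (QOnsager.DeltaSeries q ρ) n = 0) ∧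
    (∀ (k : ℕ) (X : QOnsager.Aq q ρ), ⁅QOnsager.DeltaCoef q ρ k, X⁆ = 0) := by
  have hq4 : (q ^ 2) ^ 2 ≠ 1 := by
    rw [← pow_mul]
    exact hroot _ (by norm_num)
  have hcc := QOnsager.cc_ne_zero hq hroot
  have hcoeff := QOnsager.coeff_DeltaSeries_eq hq hroot ρ
  refine ⟨hcc, hcoeff, fun n hn => QOnsager.coeff_DeltaSeries_of_ne hq
    (QOnsager.q_add_inv_ne_zero hq hq4) ρ hn, fun k X => ?_⟩
  have h := QOnsager.coeff_DeltaSeries_commute hq hq4 hρ (2 * (k : ℤ) + 2) X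
  rw [hcoeff] at h
  -- Centrality is known for c_{k+1}Δ_{k+1}; dividing by c_{k+1} ≠ 0 gives it for Δ_{k+1}.
  have h := h.smul_left (QOnsager.cc q k)⁻¹
  rw [inv_smul_smul₀ (hcc k)] at h
  exact h.lie_eq
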